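/- **Setting.** Let $\Gamma=\bigcup_{\gamma\in\mathcal E}\gamma([0,|\gamma|])\subset\mathbb R^N$ be an embedded network: $\mathcal E$ is a countable family of simple $C^1$ arcs $\gamma:[0,|\gamma|]\to\mathbb R^N$ (loops $\gamma(0)=\gamma(|\gamma|)$ allowed), parametrized by arc length, closed under reversal $\widetilde\gamma(s)=\gamma(|\gamma|-s)$, with $\gamma((0,|\gamma|))\cap\gamma'([0,|\gamma'|])=\emptyset$ whenever $\gamma'\ne\gamma,\widetilde\gamma$; any two vertices (endpoints of arcs) are linked by a finite concatenation of arcs; $\inf_{\gamma}|\gamma|>0$; and for each vertex $x$ the set $\mathcal E_x=\{\gamma\in\mathcal E:\gamma(0)=x\}$ is finite. Let $\mathbf V$ be the set of vertices, and let $d_\Gamma$ be the geodesic distance on $\Gamma$ (infimum of the lengths of finite concatenations of pieces of arcs). For each $\gamma\in\mathcal E$ let $H_\gamma:[0,|\gamma|]\times[0,\infty)\times\mathbb R\to\mathbb R$ be continuous, convex in the last variable $\mu$, with $H_{\widetilde\gamma}(s,t,\mu)=H_\gamma(|\gamma|-s,t,-\mu)$, and such that for every $T>0$: * there are nondecreasing,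 convex, superlinearly coercive $\vartheta_T,\Theta_T:[0,\infty)\to\mathbb R$ with $\vartheta_T(|\mu|)\le H_\gamma(s,t,\mu)\le\Theta_T(|\mu|)$ for all $\gamma$, $s$, $\mu$ and $t\in[0,T]$; * there are $\alpha_T,\beta_T\ge0$ and $\epsilon_T\in(0,T]$ with $H_\gamma(s,t_1,\mu)-H_\gamma(s,t_2,\mu)\le\bigl(\alpha_T\frac{H_\gamma(s,t_2,\mu)}{1+|\mu|}+\beta_T\bigr)|t_2-t_1|$ for all $\gamma$, $s$, $\mu$ and $t_1,t_2\in[0,T]$ with $|t_2-t_1|<\epsilon_T$. Put $L_\gamma(s,\lambda,t)=\max_{\mu\in\mathbb R}\{\lambda\mu-H_\gamma(s,t,\mu)\}$. Let $c_x(t)$ ($x\in\mathbf V$, $t\ge0$) be a flux limiter: continuous in $t$, with $c_x(t)\le\min_{\gamma\in\mathcal E_x}L_\gamma(0,0,t)$, and such that for every $T>0$ one has $\sup_{x\in\mathbf V,\,t\in[0,T]}|c_x(t)|<\infty$ and there are $\widehat\beta_T\ge0$, $\widehat\epsilon_T\in(0,T]$ with $c_x(t_1)-c_x(t_2)\le\widehat\beta_T|t_2-t_1|$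 for all $x\in\mathbf V$ and $t_1,t_2\in[0,T]$ with $|t_2-t_1|<\widehat\epsilon_T$. Define the overall Lagrangian by $$L(x,q,t)=L_\gamma(s,q\cdot\dot\gamma(s),t)\ \text{ if } x=\gamma(s),\ 0<s<|\gamma|,\qquad L(x,q,t)=\tfrac{|q|^2}{2}+c_x(t)\ \text{ if } x\in\mathbf V.$$ No semicontinuity of $L$ is assumed; it may be discontinuous at the vertices. **Theorem.** Let $0\le t_1\le t_2$, and let $\xi_n$ ($n\in\mathbb N$) and $\zeta$ be absolutely continuous curves from $[t_1,t_2]$ into $(\Gamma,d_\Gamma)$ with derivatives (as curves in $\mathbb R^N$) in $L^2([t_1,t_2];\mathbb R^N)$. Suppose that $\xi_n\to\zeta$ uniformly with respect to $d_\Gamma$ and that $\dot\xi_n$ converges weakly to $\dot\zeta$ in $L^2$. Then the actions of $\zeta$ and of all $\xi_n$ are well defined in $(-\infty,\infty]$ (the integrands are measurable and their negative parts are integrable), and $$\liminf_{n\to\infty}\int_{t_1}^{t_2}L(\xi_n,\dot\xi_n,\tau)\,d\tau\ \ge\ \int_{t_1}^{t_2}L(\zeta,\dot\zeta,\tau)\,d\tau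 .$$ -/

import Mathlib

open Set Filter Topology MeasureTheory

/-- An embedded network in `ℝ^N`: a family of `C¹` simple arcs parametrized by arc length, closed
under reversal of the orientation, any two of which with different supports meet only at vertices;
it is connected, the lengths are bounded away from `0`, and only finitely many arcs start at each
vertex. Loops (arcs with `arc i 0 = arc i (len i)`) are allowed. -/
structure Network (N : ℕ) (ι : Type*) where
  arc : ι → ℝ → EuclideanSpace ℝ (Fin N)
  len : ι → ℝ
  len_pos : ∀ i, 0 < len i
  contDiffOn_arc : ∀ i, ContDiffOn ℝ 1 (arc i) (Icc 0 (len i))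
  norm_deriv_arc : ∀ i, ∀ s ∈ Icc 0 (len i), ‖derivWithin (arc i) (Icc 0 (len i)) s‖ = 1
  simple_arc : ∀ i, ∀ s ∈ Icc 0 (len i), ∀ s' ∈ Icc 0 (len i), arc i s = arc i s' →
    s = s' ∨ (s = 0 ∧ s' = len i) ∨ (s = len i ∧ s' = 0)
  /-- The index of the arc with the opposite orientation. -/
  rev : ι → ι
  rev_rev : ∀ i, rev (rev i) = i
  len_rev : ∀ i, len (rev i) = len i
  arc_rev : ∀ i, ∀ s ∈ Icc 0 (len i), arc (rev i) s = arc i (len i - s)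
  no_overlap : ∀ i j, j ≠ i → j ≠ rev i →
    Disjoint (arc i '' Ioo 0 (len i)) (arc j '' Icc 0 (len j))
  /-- Any two initial points of arcs are linked by a finite concatenation of arcs. As the family is
  closed under reversal, the initial points of arcs are all the vertices. -/
  connected : ∀ i j, Relation.ReflTransGen
    (fun x y => ∃ k, arc k 0 = x ∧ arc k (len k) = y) (arc i 0) (arc j 0)
  exists_le_len : ∃ δ : ℝ, 0 < δ ∧ ∀ i, δ ≤ len i
  finite_arcs_from : ∀ x, {i | arc i 0 = x}.Finite

namespace Network

variable {N : ℕ} {ι : Type*}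

/-- The support `Γ` of the network. -/
def support (G : Network N ι) : Set (EuclideanSpace ℝ (Fin N)) :=
  ⋃ i, G.arc i '' Icc 0 (G.len i)

/-- The vertices: initial and terminal points of the arcs. -/
def vertices (G : Network N ι) : Set (EuclideanSpace ℝ (Fin N)) :=
  {x | ∃ i, x = G.arc i 0 ∨ x = G.arc i (G.len i)}

/-- The derivative `γ̇_i(s)` (one-sided at the endpoints). -/
noncomputable def tangent (G : Network N ι) (i : ι) (s : ℝ) : EuclideanSpace ℝ (Fin N) :=
  derivWithin (G.arc i) (Icc 0 (G.len i)) s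

/-- `G.Route x y ℓ`: there is a finite concatenation of pieces of arcs, contained in the network,
from `x` to `y` with total length `ℓ`. -/
inductive Route (G : Network N ι) :
    EuclideanSpace ℝ (Fin N) → EuclideanSpace ℝ (Fin N) → ℝ → Prop
  | refl (x : EuclideanSpace ℝ (Fin N)) : Route G x x 0
  | step (i : ι) (s s' : ℝ) (hs : s ∈ Icc 0 (G.len i)) (hs' : s' ∈ Icc 0 (G.len i))
      (y : EuclideanSpace ℝ (Fin N)) (l : ℝ) (h : Route G (G.arc i s') y l) :
      Route G (G.arc i s) y (|s - s'| + l)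

/-- The geodesic distance `d_Γ`: the infimum of the lengths of the routes between two points. -/
noncomputable def geodist (G : Network N ι) (x y : EuclideanSpace ℝ (Fin N)) : ℝ :=
  sInf {l | G.Route x y l}

/-- The points of `Γ`. This is a structure, not a subtype, so that its metric is the geodesic
distance and not the restriction of the Euclidean distance. -/
structure Point (G : Network N ι) where
  pos : EuclideanSpace ℝ (Fin N)
  mem : pos ∈ G.support

theorem Route.nonneg {G : Network N ι} {x y : EuclideanSpace ℝ (Fin N)} {l : ℝ}
    (h : G.Route x y l) : 0 ≤ l := by
  induction h with
  | refl => exact le_rfl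
  | step i s s' _ _ y l _ ih => positivity

theorem Route.trans {G : Network N ι} {x y z : EuclideanSpace ℝ (Fin N)} {l l' : ℝ}
    (h : G.Route x y l) (h' : G.Route y z l') : G.Route x z (l + l') := by
  induction h with
  | refl => simpa using h'
  | step i s s' hs hs' y l _ ih =>
    rw [add_assoc]
    exact Route.step i s s' hs hs' _ _ (ih h')

theorem Route.single {G : Network N ι} (i : ι) {s s' : ℝ} (hs : s ∈ Icc 0 (G.len i))
    (hs' : s' ∈ Icc 0 (G.len i)) : G.Route (G.arc i s) (G.arc i s') |s - s'| := by
  simpa using Route.step i s s' hs hs' _ 0 (Route.refl _)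

theorem Route.symm {G : Network N ι} {x y : EuclideanSpace ℝ (Fin N)} {l : ℝ}
    (h : G.Route x y l) : G.Route y x l := by
  induction h with
  | refl => exact Route.refl _
  | step i s s' hs hs' y l _ ih =>
    rw [add_comm, abs_sub_comm]
    exact ih.trans (Route.single i hs' hs)

theorem exists_route (G : Network N ι) (x y : G.Point) : ∃ l, G.Route x.pos y.pos l := by
  obtain ⟨x, hx⟩ := x
  obtain ⟨y, hy⟩ := y
  obtain ⟨i, s, hs, rfl⟩ := mem_iUnion.1 hx
  obtain ⟨j, s', hs', rfl⟩ := mem_iUnion.1 hy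
  have key : ∃ l, G.Route (G.arc i 0) (G.arc j 0) l := by
    have h0 := G.connected i j
    generalize G.arc j 0 = z at h0
    induction h0 with
    | refl => exact ⟨0, Route.refl _⟩
    | tail _ h ih =>
      obtain ⟨k, rfl, rfl⟩ := h
      obtain ⟨l, hl⟩ := ih
      exact ⟨_, hl.trans (Route.single k ⟨le_rfl, (G.len_pos k).le⟩ ⟨(G.len_pos k).le, le_rfl⟩)⟩
  obtain ⟨l, hl⟩ := key
  exact ⟨_, ((Route.single i hs ⟨le_rfl, (G.len_pos i).le⟩).trans hl).trans
    (Route.single j ⟨le_rfl, (G.len_pos j).le⟩ hs')⟩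

theorem dist_arc_le (G : Network N ι) (i : ι) {s s' : ℝ} (hs : s ∈ Icc 0 (G.len i))
    (hs' : s' ∈ Icc 0 (G.len i)) : dist (G.arc i s) (G.arc i s') ≤ |s - s'| := by
  have h := (convex_Icc (0 : ℝ) (G.len i)).norm_image_sub_le_of_norm_derivWithin_le
    (f := G.arc i) (C := 1) ((G.contDiffOn_arc i).differentiableOn one_ne_zero)
    (fun x hx => (G.norm_deriv_arc i x hx).le) hs' hs
  simpa [dist_eq_norm] using h

theorem Route.dist_le {G : Network N ι} {x y : EuclideanSpace ℝ (Fin N)} {l : ℝ}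
    (h : G.Route x y l) : dist x y ≤ l := by
  induction h with
  | refl => simp
  | step i s s' hs hs' y l _ ih =>
    exact (dist_triangle _ _ _).trans (add_le_add (G.dist_arc_le i hs hs') ih)

theorem geodist_le {G : Network N ι} {x y : EuclideanSpace ℝ (Fin N)} {l : ℝ}
    (h : G.Route x y l) : G.geodist x y ≤ l :=
  csInf_le ⟨0, fun _ hl => Route.nonneg hl⟩ h

/-- `Γ` with the geodesic distance `d_Γ` as its metric. -/
noncomputable instance (G : Network N ι) : MetricSpace G.Point where
  dist x y := G.geodist x.pos y.pos
  dist_self x := le_antisymm (geodist_le (Route.refl _))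
    (le_csInf ⟨0, Route.refl _⟩ fun _ hl => Route.nonneg hl)
  dist_comm x y := by
    have h : {l | G.Route x.pos y.pos l} = {l | G.Route y.pos x.pos l} :=
      Set.ext fun l => ⟨Route.symm, Route.symm⟩
    simp only [geodist, h]
  dist_triangle x y z := by
    refine le_of_forall_pos_lt_add fun ε hε => ?_
    obtain ⟨l, hl, hl'⟩ := exists_lt_of_csInf_lt (G.exists_route x y)
      (lt_add_of_pos_right (G.geodist x.pos y.pos) (half_pos hε))
    obtain ⟨m, hm, hm'⟩ := exists_lt_of_csInf_lt (G.exists_route y z)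
      (lt_add_of_pos_right (G.geodist y.pos z.pos) (half_pos hε))
    have := geodist_le (Route.trans hl hm)
    linarith
  eq_of_dist_eq_zero {x y} h := by
    have h' : dist x.pos y.pos ≤ 0 := h ▸ le_csInf (G.exists_route x y) fun _ hl => Route.dist_le hl
    cases x
    cases y
    congr
    exact dist_le_zero.1 h'

end Network

/-- Nondecreasing, convex and superlinearly coercive functions `[0, ∞) → ℝ`. -/
structure IsSuperlinearGauge (θ : ℝ → ℝ) : Prop where
  monotoneOn : MonotoneOn θ (Ici 0)
  convexOn : ConvexOn ℝ (Ici 0) θ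
  superlinear : Tendsto (fun r => θ r / r) atTop atTop

/-- A Hamiltonian on the network: functions `H_i(s, t, μ)` on `[0, |γ_i|] × [0, ∞) × ℝ`, compatible
with reversal of arcs, continuous, convex in `μ`, with superlinear bounds uniform in the arc and
locally uniform in time, and with a Lipschitz type condition in time. -/
structure NetworkHamiltonian {N : ℕ} {ι : Type*} (G : Network N ι) where
  H : ι → ℝ → ℝ → ℝ → ℝ
  compat : ∀ i, ∀ s ∈ Icc 0 (G.len i), ∀ t, 0 ≤ t → ∀ μ,
    H (G.rev i) s t μ = H i (G.len i - s) t (-μ)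
  continuousOn : ∀ i, ContinuousOn (fun p : ℝ × ℝ × ℝ => H i p.1 p.2.1 p.2.2)
    (Icc 0 (G.len i) ×ˢ Ici 0 ×ˢ univ)
  convex : ∀ i, ∀ s ∈ Icc 0 (G.len i), ∀ t, 0 ≤ t → ConvexOn ℝ univ (H i s t)
  coercive : ∀ T : ℝ, 0 < T → ∃ θ Θ : ℝ → ℝ, IsSuperlinearGauge θ ∧ IsSuperlinearGauge Θ ∧
    ∀ i, ∀ s ∈ Icc 0 (G.len i), ∀ t ∈ Icc 0 T, ∀ μ, θ |μ| ≤ H i s t μ ∧ H i s t μ ≤ Θ |μ|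
  lipschitz_time : ∀ T : ℝ, 0 < T → ∃ α β ε : ℝ, 0 ≤ α ∧ 0 ≤ β ∧ 0 < ε ∧ ε ≤ T ∧
    ∀ i, ∀ s ∈ Icc 0 (G.len i), ∀ μ, ∀ t₁ ∈ Icc 0 T, ∀ t₂ ∈ Icc 0 T, |t₂ - t₁| < ε →
      H i s t₁ μ - H i s t₂ μ ≤ (α * (H i s t₂ μ / (1 + |μ|)) + β) * |t₂ - t₁|

namespace NetworkHamiltonian

variable {N : ℕ} {ι : Type*} {G : Network N ι}

/-- The Lagrangian `L_i(s, λ, t) = max_μ (λ μ - H_i(s, t, μ))` of the arc `i`; the maximum is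
attained by the continuity and coercivity of `H_i`. -/
noncomputable def arcLagrangian (𝓗 : NetworkHamiltonian G) (i : ι) (s v t : ℝ) : ℝ :=
  ⨆ μ : ℝ, (v * μ - 𝓗.H i s t μ)

theorem arcLagrangian_rev (𝓗 : NetworkHamiltonian G) (i : ι) {s : ℝ} (hs : s ∈ Icc 0 (G.len i))
    (v : ℝ) {t : ℝ} (ht : 0 ≤ t) :
    𝓗.arcLagrangian (G.rev i) (G.len i - s) v t = 𝓗.arcLagrangian i s (-v) t := by
  have hmem : G.len i - s ∈ Icc 0 (G.len i) := ⟨by linarith [hs.2], by linarith [hs.1]⟩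
  unfold arcLagrangian
  rw [← (Equiv.neg ℝ).iSup_comp]
  refine iSup_congr fun μ => ?_
  simp [𝓗.compat i _ hmem t ht]

end NetworkHamiltonian

/-- A flux limiter `c_x(t)`, for `x` a vertex and `t ≥ 0`: continuous in `t`, bounded above by
`min_{i ∈ E_x} L_i(0, 0, t)`, bounded uniformly in `x` and locally uniformly in `t`, and with a
Lipschitz condition in time uniform in `x`. -/
structure FluxLimiter {N : ℕ} {ι : Type*} {G : Network N ι} (𝓗 : NetworkHamiltonian G) where
  c : EuclideanSpace ℝ (Fin N) → ℝ → ℝ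
  continuousOn : ∀ x ∈ G.vertices, ContinuousOn (c x) (Ici 0)
  le_arcLagrangian : ∀ x ∈ G.vertices, ∀ t, 0 ≤ t → ∀ i, G.arc i 0 = x →
    c x t ≤ 𝓗.arcLagrangian i 0 0 t
  bounded : ∀ T : ℝ, 0 < T → ∃ C : ℝ, ∀ x ∈ G.vertices, ∀ t ∈ Icc 0 T, |c x t| ≤ C
  lipschitz_time : ∀ T : ℝ, 0 < T → ∃ β ε : ℝ, 0 ≤ β ∧ 0 < ε ∧ ε ≤ T ∧
    ∀ x ∈ G.vertices, ∀ t₁ ∈ Icc 0 T, ∀ t₂ ∈ Icc 0 T, |t₂ - t₁| < ε →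
      c x t₁ - c x t₂ ≤ β * |t₂ - t₁|

namespace Network

variable {N : ℕ} {ι : Type*}

theorem exists_interior_of_not_mem_vertices (G : Network N ι) (x : G.Point)
    (hx : x.pos ∉ G.vertices) :
    ∃ p : ι × ℝ, p.2 ∈ Ioo 0 (G.len p.1) ∧ G.arc p.1 p.2 = x.pos := by
  obtain ⟨i, s, hs, h⟩ := mem_iUnion.1 x.mem
  refine ⟨(i, s), ⟨lt_of_le_of_ne hs.1 ?_, lt_of_le_of_ne hs.2 ?_⟩, h⟩
  · intro h0
    exact hx ⟨i, Or.inl (h.symm.trans (congrArg (G.arc i) h0.symm))⟩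
  · intro h0
    exact hx ⟨i, Or.inr (h.symm.trans (congrArg (G.arc i) h0))⟩

theorem arc_not_mem_vertices (G : Network N ι) {i : ι} {s : ℝ} (hs : s ∈ Ioo 0 (G.len i)) :
    G.arc i s ∉ G.vertices := by
  have main : ∀ j, ∀ e, (e = 0 ∨ e = G.len j) → G.arc i s ≠ G.arc j e := by
    intro j e he h
    have hej : e ∈ Icc 0 (G.len j) := by
      have := (G.len_pos j).le
      rcases he with rfl | rfl <;> constructor <;> linarith
    have hsi : s ∈ Icc 0 (G.len i) := Ioo_subset_Icc_self hs
    by_cases h1 : j = i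
    · subst h1
      have := G.simple_arc j s hsi e hej h
      grind
    by_cases h2 : j = G.rev i
    · subst h2
      rw [G.len_rev] at he hej
      rw [G.arc_rev i e hej] at h
      have := G.simple_arc i s hsi (G.len i - e) ⟨by linarith [hej.2], by linarith [hej.1]⟩ h
      grind
    exact (Set.disjoint_left.1 (G.no_overlap i j h1 h2) ⟨s, hs, rfl⟩) ⟨e, hej, h.symm⟩
  rintro ⟨j, h | h⟩
  · exact main j _ (Or.inl rfl) h
  · exact main j _ (Or.inr rfl) h

theorem eq_or_rev_of_arc_eq (G : Network N ι) {i j : ι} {s s' : ℝ} (hs : s ∈ Ioo 0 (G.len i))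
    (hs' : s' ∈ Ioo 0 (G.len j)) (h : G.arc i s = G.arc j s') :
    (j = i ∧ s' = s) ∨ (j = G.rev i ∧ s' = G.len i - s) := by
  have hsi : s ∈ Icc 0 (G.len i) := Ioo_subset_Icc_self hs
  have hsj : s' ∈ Icc 0 (G.len j) := Ioo_subset_Icc_self hs'
  by_cases h1 : j = i
  · subst h1
    have := G.simple_arc j s hsi s' hsj h
    grind
  by_cases h2 : j = G.rev i
  · subst h2
    rw [G.len_rev] at hs' hsj
    rw [G.arc_rev i s' hsj] at h
    have := G.simple_arc i s hsi (G.len i - s') ⟨by linarith [hsj.2], by linarith [hsj.1]⟩ h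
    grind
  exact absurd ⟨s', hsj, h.symm⟩ (Set.disjoint_left.1 (G.no_overlap i j h1 h2) ⟨s, hs, rfl⟩)

theorem tangent_rev (G : Network N ι) (i : ι) {s : ℝ} (hs : s ∈ Icc 0 (G.len i)) :
    G.tangent (G.rev i) (G.len i - s) = -G.tangent i s := by
  have hmem : G.len i - s ∈ Icc 0 (G.len i) := ⟨by linarith [hs.2], by linarith [hs.1]⟩
  have h1 : HasDerivWithinAt (G.arc i) (G.tangent i s) (Icc 0 (G.len i))
      (G.len i - (G.len i - s)) := by
    rw [sub_sub_cancel]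
    exact ((G.contDiffOn_arc i).differentiableOn one_ne_zero s hs).hasDerivWithinAt
  have h2 : HasDerivWithinAt (fun r => G.len i - r) (-1 : ℝ) (Icc 0 (G.len i)) (G.len i - s) := by
    simpa using (hasDerivWithinAt_id (G.len i - s) (Icc 0 (G.len i))).const_sub (G.len i)
  have h3 := h1.scomp (G.len i - s) h2 fun r hr => ⟨by linarith [hr.2], by linarith [hr.1]⟩
  have h4 : HasDerivWithinAt (G.arc (G.rev i)) ((-1 : ℝ) • G.tangent i s) (Icc 0 (G.len i))
      (G.len i - s) := h3.congr (fun r hr => G.arc_rev i r hr) (G.arc_rev i _ hmem)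
  have h5 := h4.derivWithin (uniqueDiffOn_Icc (G.len_pos i) _ hmem)
  simpa [tangent, G.len_rev] using h5

end Network

namespace FluxLimiter

variable {N : ℕ} {ι : Type*} {G : Network N ι} {𝓗 : NetworkHamiltonian G}

open Classical in
/-- The overall Lagrangian `L(x, q, t)`: it is `|q|²/2 + c_x(t)` at a vertex `x`, and
`L_i(s, q · γ̇_i(s), t)` at a point `x = γ_i(s)` with `0 < s < |γ_i|`. Such a pair `(i, s)` is unique
up to reversal of the arc, which does not change the value, see `lagrangian_of_mem_Ioo`. -/
noncomputable def lagrangian (F : FluxLimiter 𝓗) (x : G.Point)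
    (q : EuclideanSpace ℝ (Fin N)) (t : ℝ) : ℝ :=
  if h : x.pos ∈ G.vertices then ‖q‖ ^ 2 / 2 + F.c x.pos t
  else
    let p := Classical.choose (G.exists_interior_of_not_mem_vertices x h)
    𝓗.arcLagrangian p.1 p.2 (inner ℝ q (G.tangent p.1 p.2)) t

theorem lagrangian_of_mem_vertices (F : FluxLimiter 𝓗) (x : G.Point)
    (q : EuclideanSpace ℝ (Fin N)) (t : ℝ) (h : x.pos ∈ G.vertices) :
    F.lagrangian x q t = ‖q‖ ^ 2 / 2 + F.c x.pos t := by
  simp [lagrangian, h]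

theorem lagrangian_of_mem_Ioo (F : FluxLimiter 𝓗) (x : G.Point)
    (q : EuclideanSpace ℝ (Fin N)) {t : ℝ} (ht : 0 ≤ t) {i : ι} {s : ℝ}
    (hs : s ∈ Ioo 0 (G.len i)) (hx : G.arc i s = x.pos) :
    F.lagrangian x q t = 𝓗.arcLagrangian i s (inner ℝ q (G.tangent i s)) t := by
  have h : x.pos ∉ G.vertices := hx ▸ G.arc_not_mem_vertices hs
  have hp := Classical.choose_spec (G.exists_interior_of_not_mem_vertices x h)
  simp only [lagrangian, h, dif_neg, not_false_eq_true]
  generalize Classical.choose (G.exists_interior_of_not_mem_vertices x h) = p at hp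
  obtain ⟨j, s'⟩ := p
  rcases G.eq_or_rev_of_arc_eq hs hp.1 (hx.trans hp.2.symm) with ⟨h1, h2⟩ | ⟨h1, h2⟩
  · simp only at h1 h2
    subst h1 h2
    rfl
  · simp only at h1 h2
    subst h1 h2
    have hs' : s ∈ Icc 0 (G.len i) := Ioo_subset_Icc_self hs
    rw [G.tangent_rev i hs', inner_neg_right, 𝓗.arcLagrangian_rev i hs' _ ht, neg_neg]

/-- The integrand `τ ↦ L(ξ(τ), ξ'(τ), τ)` of the action; `ξ'` is the derivative of `ξ` as a curve in
`ℝ^N`, which exists almost everywhere if `ξ` is absolutely continuous. -/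
noncomputable def integrand (F : FluxLimiter 𝓗) (ξ : ℝ → G.Point) (τ : ℝ) : ℝ :=
  F.lagrangian (ξ τ) (deriv (fun r => (ξ r).pos) τ) τ

/-- The action `∫_{t₁}^{t₂} L(ξ, ξ', τ) dτ`, with values in the extended reals: the integral of the
positive part minus the integral of the negative part. -/
noncomputable def action (F : FluxLimiter 𝓗) (t₁ t₂ : ℝ) (ξ : ℝ → G.Point) : EReal :=
  ((∫⁻ τ in Icc t₁ t₂, ENNReal.ofReal (F.integrand ξ τ) : ENNReal) : EReal) -
    ((∫⁻ τ in Icc t₁ t₂, ENNReal.ofReal (-F.integrand ξ τ) : ENNReal) : EReal)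

/-- The action of `ξ` is well defined in `(-∞, ∞]`: the integrand is measurable and the integral of
its negative part is finite. -/
def ActionWellDefined (F : FluxLimiter 𝓗) (t₁ t₂ : ℝ) (ξ : ℝ → G.Point) : Prop :=
  AEMeasurable (F.integrand ξ) (volume.restrict (Icc t₁ t₂)) ∧
    ∫⁻ τ in Icc t₁ t₂, ENNReal.ofReal (-F.integrand ξ τ) < ⊤

end FluxLimiter

/-! Adding a constant `K` makes all integrands nonnegative, because `L ≥ -H(·,·,0)` inside the arcs
and `L ≥ c_x` at the vertices. The time interval is then covered by countably many measurable sets: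
the times at which `ζ` sits at a given vertex, and those at which it lies in a given piece of the
interior of an arc. By Fatou's lemma for series (`lintegral_le_liminf_of_cover`) it suffices to
prove the inequality on every measurable subset of each such set.

Arcs are read through tent functions, 1-Lipschitz functions on all of `Γ` that agree, up to a shift,
with arc length on the ascending half. Composed with the curves they give real absolutely continuous
functions that converge uniformly on the whole interval, with derivatives bounded in `L²`, hence
weakly convergent (`tendsto_integral_mul_deriv`).

On an arc, `L` is a supremum of affine functions of the velocity, `v q - H(s,t,q)`. For fixed `k`, a
momentum is chosen measurably among the first terms of a dense sequence so as to be optimal along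
`ζ`. It is bounded and independent of `n`, so the term linear in the velocity passes to the limit
weakly and the Hamiltonian term by dominated convergence. Letting `k → ∞` recovers `L` along `ζ`
(`lintegral_le_liminf_of_arc`).

At a vertex `x`, `ζ' = 0` almost everywhere, so the limit integrand is `c_x`. The curves `ξ_n` may
move on any arc issuing from `x`, or rest at `x`. A single minorant serves all cases: the sum over
these arcs of momentum times tent derivative, in which at most one term is nonzero, plus the minimum
of `c_x` and of all `-H_i`. Its limit tends, as `k → ∞`, to `min_i min(c_x, L_i(0,0,·))`, which is
`c_x` exactly because the flux limiter satisfies `c_x ≤ L_i(0,0,·)`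
(`lintegral_le_liminf_of_vertex`). This inequality replaces semicontinuity of `L`. -/

/-! ### Absolutely continuous functions and level sets -/

theorem LipschitzWith.comp_absolutelyContinuousOnInterval {X Y : Type*} [PseudoMetricSpace X]
    [PseudoMetricSpace Y] {K : NNReal} {σ : X → Y} (hσ : LipschitzWith K σ) {f : ℝ → X} {a b : ℝ}
    (hf : AbsolutelyContinuousOnInterval f a b) :
    AbsolutelyContinuousOnInterval (fun t => σ (f t)) a b := by
  have h0 : Tendsto (fun E : ℕ × (ℕ → ℝ × ℝ) =>
      (K : ℝ) * ∑ i ∈ Finset.range E.1, dist (f (E.2 i).1) (f (E.2 i).2))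
      (AbsolutelyContinuousOnInterval.totalLengthFilter ⊓
        𝓟 (AbsolutelyContinuousOnInterval.disjWithin a b)) (𝓝 0) := by
    simpa using Tendsto.const_mul (K : ℝ) hf
  refine squeeze_zero (fun E => Finset.sum_nonneg fun i _ => dist_nonneg) (fun E => ?_) h0
  rw [Finset.mul_sum]
  exact Finset.sum_le_sum fun i _ => hσ.dist_le_mul _ _

/-- On a level set of a function of a real variable, its derivative vanishes almost everywhere. -/
theorem ae_deriv_eq_zero_of_eq {E : Type*} [NormedAddCommGroup E] [NormedSpace ℝ E]
    (f : ℝ → E) (x : E) : ∀ᵐ τ, f τ = x → deriv f τ = 0 := by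
  have hc : {τ | f τ = x ∧ deriv f τ ≠ 0}.Countable := by
    -- A point of the level set with nonzero derivative is isolated in it from the right, and a
    -- subset of the line has only countably many such points.
    refine (countable_setOfPred_isolated_right_within (s := {τ | f τ = x})).mono ?_
    rintro τ ⟨h1, h2⟩
    have hd : HasDerivAt f (deriv f τ) τ := by
      refine DifferentiableAt.hasDerivAt ?_
      by_contra h
      exact h2 (deriv_zero_of_not_differentiableAt h)
    have h3 := hd.eventually_ne (c := x) h2
    have h4 : ∀ᶠ z in 𝓝[{τ | f τ = x} ∩ Ioi τ] τ, f z ≠ x :=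
      h3.filter_mono (nhdsWithin_mono _ fun z hz => ne_of_gt hz.2)
    refine ⟨h1, eq_bot_iff.2 fun _ _ => ?_⟩
    filter_upwards [h4, self_mem_nhdsWithin] with z hz hz'
    exact absurd hz'.1 hz
  filter_upwards [hc.ae_notMem volume] with τ hτ h
  by_contra h'
  exact hτ ⟨h, h'⟩

/-! ### Weak convergence of derivatives in `L²` -/

theorem abs_integral_mul_le_eLpNorm {α : Type*} [MeasurableSpace α] {μ : Measure α} {f g : α → ℝ}
    (hf : MemLp f 2 μ) (hg : MemLp g 2 μ) :
    |∫ x, f x * g x ∂μ| ≤ (eLpNorm f 2 μ).toReal * (eLpNorm g 2 μ).toReal := by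
  have h := eLpNorm_smul_le_mul_eLpNorm (p := 2) (q := 2) (r := 1) (μ := μ) hg.1 hf.1
  rw [← ENNReal.toReal_mul, ← Real.norm_eq_abs]
  refine (norm_integral_le_lintegral_norm _).trans ?_
  refine ENNReal.toReal_mono (ENNReal.mul_ne_top hf.2.ne hg.2.ne) (le_trans (le_of_eq ?_) h)
  rw [eLpNorm_one_eq_lintegral_enorm]
  exact lintegral_congr fun x => ofReal_norm _

/-- Bounded continuous functions are dense in `L²`, and Weierstrass approximation on `[a, b]` is
uniform, hence also in `L²` of a finite measure. Polynomials are wanted because they can be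
integrated by parts. -/
theorem exists_polynomial_eLpNorm_sub_le {a b : ℝ} {φ : ℝ → ℝ}
    (hφ : MemLp φ 2 (volume.restrict (Icc a b))) {ε : ENNReal} (hε : ε ≠ 0) :
    ∃ p : Polynomial ℝ, eLpNorm (fun x => φ x - p.eval x) 2 (volume.restrict (Icc a b)) ≤ ε := by
  have hε2 : ε / 2 ≠ 0 := by simp [hε]
  obtain ⟨g, hg, hg2⟩ := hφ.exists_boundedContinuous_eLpNorm_sub_le (by simp) hε2
  -- The square root of the length of the interval, the factor between the uniform and the `L²`
  -- norm.
  set V : ENNReal := (volume.restrict (Icc a b)) univ ^ ((2 : ENNReal).toReal⁻¹) with hV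
  have hVtop : V ≠ ⊤ := by
    refine ENNReal.rpow_ne_top_of_nonneg (by positivity) ?_
    simp
  obtain ⟨δ, hδ, hδ'⟩ : ∃ δ : NNReal, 0 < δ ∧ V * δ ≤ ε / 2 := by
    obtain ⟨δ, hδ, h⟩ := ENNReal.exists_nnreal_pos_mul_lt hVtop hε2
    exact ⟨δ, hδ, by rw [mul_comm]; exact h.le⟩
  obtain ⟨p, hp⟩ := exists_polynomial_near_of_continuousOn a b g g.continuous.continuousOn δ hδ
  refine ⟨p, ?_⟩
  have h1 : (fun x => φ x - p.eval x) = (φ - (g : ℝ → ℝ)) + fun x => g x - p.eval x := by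
    ext x; simp
  rw [h1]
  have hpm : AEStronglyMeasurable (fun x => g x - p.eval x) (volume.restrict (Icc a b)) :=
    (g.continuous.sub p.continuous).aestronglyMeasurable
  refine (eLpNorm_add_le (hφ.sub hg2).1 hpm (by norm_num)).trans ?_
  rw [← ENNReal.add_halves ε]
  refine add_le_add hg (le_trans (eLpNorm_le_of_ae_bound (C := δ) ?_) (le_trans ?_ hδ'))
  · filter_upwards [ae_restrict_mem measurableSet_Icc] with x hx
    rw [Real.norm_eq_abs, abs_sub_comm]
    exact (hp x hx).le
  · simp [hV]

/-- Integration by parts moves the derivative onto the polynomial; what remains involves only the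
values of `w n`, which converge uniformly. -/
theorem tendsto_integral_polynomial_mul_deriv {a b : ℝ} (hab : a ≤ b) {w : ℕ → ℝ → ℝ} {v : ℝ → ℝ}
    (hw : ∀ n, AbsolutelyContinuousOnInterval (w n) a b)
    (hv : AbsolutelyContinuousOnInterval v a b)
    (h : TendstoUniformlyOn w v atTop (Icc a b)) (p : Polynomial ℝ) :
    Tendsto (fun n => ∫ x in Icc a b, p.eval x * deriv (w n) x) atTop
      (𝓝 (∫ x in Icc a b, p.eval x * deriv v x)) := by
  have hp : AbsolutelyContinuousOnInterval (fun x => p.eval x) a b :=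
    ContDiffOn.absolutelyContinuousOnInterval (by simpa [Polynomial.coe_aeval_eq_eval] using! (p.contDiff_aeval 1).contDiffOn)
  simp only [integral_Icc_eq_integral_Ioc, ← intervalIntegral.integral_of_le hab]
  have hrw : ∀ u, AbsolutelyContinuousOnInterval u a b → ∫ x in a..b, p.eval x * deriv u x =
      p.eval b * u b - p.eval a * u a - ∫ x in a..b, deriv (fun x => p.eval x) x * u x :=
    fun u hu => hp.integral_mul_deriv_eq_deriv_mul hu
  rw [hrw v hv]
  simp only [fun n => hrw (w n) (hw n)]
  have hpt : ∀ x ∈ Icc a b, Tendsto (fun n => w n x) atTop (𝓝 (v x)) := fun x hx =>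
    h.tendsto_at hx
  refine (((hpt b (right_mem_Icc.2 hab)).const_mul _).sub
    ((hpt a (left_mem_Icc.2 hab)).const_mul _)).sub ?_
  have hpc : Continuous (deriv fun x => p.eval x) := by
    have : (deriv fun x => p.eval x) = fun x => p.derivative.eval x := by
      ext x; exact p.deriv
    rw [this]; exact p.derivative.continuous
  obtain ⟨D, hD⟩ := isCompact_Icc.exists_bound_of_continuousOn (hpc.continuousOn (s := Icc a b))
  obtain ⟨C, hC⟩ := hv.exists_bound
  rw [uIcc_of_le hab] at hC
  refine intervalIntegral.tendsto_integral_filter_of_dominated_convergence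
    -- `C` bounds `v`, and `w n` is eventually within distance `1` of `v`.
    (fun _ => D * (C + 1)) ?_ ?_ (by simp) ?_
  · refine Eventually.of_forall fun n => ContinuousOn.aestronglyMeasurable ?_ measurableSet_uIoc
    exact (hpc.continuousOn.mul (hw n).continuousOn).mono uIoc_subset_uIcc
  · filter_upwards [Metric.tendstoUniformlyOn_iff.1 h 1 one_pos] with n hn
    refine ae_of_all _ fun x hx => ?_
    have hx' : x ∈ Icc a b := by rw [← uIcc_of_le hab]; exact uIoc_subset_uIcc hx
    rw [norm_mul]
    refine mul_le_mul (hD x hx') ?_ (norm_nonneg _) ((norm_nonneg _).trans (hD x hx'))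
    have h1 := hn x hx'
    rw [dist_comm, Real.dist_eq, ← Real.norm_eq_abs] at h1
    have h2 := norm_le_norm_add_norm_sub' (w n x) (v x)
    linarith [hC x hx']
  · refine ae_of_all _ fun x hx => (hpt x ?_).const_mul _
    rw [← uIcc_of_le hab]; exact uIoc_subset_uIcc hx

/-- The derivatives of uniformly converging absolutely continuous functions converge weakly in `L²`
if they are bounded in `L²`. -/
theorem tendsto_integral_mul_deriv {a b : ℝ} (hab : a ≤ b) {w : ℕ → ℝ → ℝ} {v : ℝ → ℝ}
    (hw : ∀ n, AbsolutelyContinuousOnInterval (w n) a b)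
    (hv : AbsolutelyContinuousOnInterval v a b)
    (h : TendstoUniformlyOn w v atTop (Icc a b)) {M : NNReal}
    (hwM : ∀ n, eLpNorm (deriv (w n)) 2 (volume.restrict (Icc a b)) ≤ M)
    (hvM : eLpNorm (deriv v) 2 (volume.restrict (Icc a b)) ≤ M) {φ : ℝ → ℝ}
    (hφ : MemLp φ 2 (volume.restrict (Icc a b))) :
    Tendsto (fun n => ∫ x in Icc a b, φ x * deriv (w n) x) atTop
      (𝓝 (∫ x in Icc a b, φ x * deriv v x)) := by
  have hmem : ∀ {u : ℝ → ℝ}, eLpNorm (deriv u) 2 (volume.restrict (Icc a b)) ≤ M →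
      MemLp (deriv u) 2 (volume.restrict (Icc a b)) := fun hu =>
    ⟨(measurable_deriv _).aestronglyMeasurable, hu.trans_lt ENNReal.coe_lt_top⟩
  rw [Metric.tendsto_atTop]
  intro ε hε
  -- Replacing `φ` by a polynomial at `L²` distance at most `δ` costs at most `δ * M` in each
  -- integral, uniformly in `n`, by Cauchy–Schwarz.
  obtain ⟨δ, hδ, hδε⟩ : ∃ δ : NNReal, 0 < δ ∧ (δ : ℝ) * M < ε / 3 := by
    refine ⟨(ε / 3 / (M + 1)).toNNReal, by simp; positivity, ?_⟩
    · rw [Real.coe_toNNReal _ (by positivity)]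
      rw [div_mul_eq_mul_div, div_lt_iff₀ (by positivity)]
      nlinarith
  obtain ⟨p, hp⟩ := exists_polynomial_eLpNorm_sub_le hφ (ε := δ) (by simpa using hδ.ne')
  have hpm : MemLp (fun x => p.eval x) 2 (volume.restrict (Icc a b)) := by
    obtain ⟨D, hD⟩ := isCompact_Icc.exists_bound_of_continuousOn
      (p.continuous.continuousOn (s := Icc a b))
    exact MemLp.of_bound p.continuous.aestronglyMeasurable D
      ((ae_restrict_mem measurableSet_Icc).mono fun x hx => hD x hx)
  have key : ∀ {u : ℝ → ℝ}, eLpNorm (deriv u) 2 (volume.restrict (Icc a b)) ≤ M →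
      |(∫ x in Icc a b, φ x * deriv u x) - ∫ x in Icc a b, p.eval x * deriv u x| < ε / 3 := by
    intro u hu
    have h1 : Integrable (fun x => φ x * deriv u x) (volume.restrict (Icc a b)) :=
      hφ.integrable_mul (hmem hu)
    have h2 : Integrable (fun x => p.eval x * deriv u x) (volume.restrict (Icc a b)) :=
      hpm.integrable_mul (hmem hu)
    rw [← integral_sub h1 h2]
    simp only [← sub_mul]
    refine (abs_integral_mul_le_eLpNorm (hφ.sub hpm) (hmem hu)).trans_lt (lt_of_le_of_lt ?_ hδε)
    refine mul_le_mul ?_ ?_ ENNReal.toReal_nonneg δ.2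
    · exact ENNReal.toReal_mono ENNReal.coe_ne_top hp
    · exact ENNReal.toReal_mono ENNReal.coe_ne_top hu
  obtain ⟨n₀, hn₀⟩ := Metric.tendsto_atTop.1
    (tendsto_integral_polynomial_mul_deriv hab hw hv h p) (ε / 3) (by positivity)
  refine ⟨n₀, fun n hn => ?_⟩
  have h1 := key (hwM n)
  have h2 := key hvM
  have h3 := hn₀ n hn
  rw [Real.dist_eq] at h3 ⊢
  rw [abs_lt] at *
  constructor <;> linarith

/-- Weakly convergent sequences in `L²` are bounded. -/
theorem exists_eLpNorm_le_of_tendsto_integral_inner {α E : Type*} [MeasurableSpace α]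
    [NormedAddCommGroup E] [InnerProductSpace ℝ E] [CompleteSpace E] {μ : Measure α}
    {f : ℕ → α → E} (hf : ∀ n, MemLp (f n) 2 μ) {l : (α → E) → ℝ}
    (h : ∀ φ : α → E, MemLp φ 2 μ →
      Tendsto (fun n => ∫ x, inner ℝ (φ x) (f n x) ∂μ) atTop (𝓝 (l φ))) :
    ∃ M : NNReal, ∀ n, eLpNorm (f n) 2 μ ≤ M := by
  -- Pairing with `f n` is a functional of norm equal to the `L²` norm of `f n`; convergence of the
  -- pairings makes these functionals pointwise bounded.
  obtain ⟨C, hC⟩ := banach_steinhaus (g := fun n => innerSL ℝ ((hf n).toLp (f n))) (fun φ => by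
    obtain ⟨C, hC⟩ := (h φ (Lp.memLp φ)).norm.bddAbove_range
    refine ⟨C, fun n => le_of_eq_of_le ?_ (hC ⟨n, rfl⟩)⟩
    congr 1
    rw [innerSL_apply_apply, real_inner_comm, L2.inner_def]
    refine integral_congr_ae ?_
    filter_upwards [(hf n).coeFn_toLp] with x hx
    rw [hx])
  refine ⟨C.toNNReal, fun n => ?_⟩
  have h1 := hC n
  rw [innerSL_apply_norm, Lp.norm_toLp] at h1
  rw [← ENNReal.ofReal_toReal (hf n).2.ne]
  exact ENNReal.ofReal_le_ofReal h1

/-! ### Fatou-type inequalities and measurable selection -/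

/-- The inequality of Fatou's lemma holds if it holds on the measurable subsets of the members of a
countable cover. -/
theorem lintegral_le_liminf_of_cover {α κ : Type*} [MeasurableSpace α] {μ : Measure α} [Countable κ]
    {A : κ → Set α} (hA : ∀ k, MeasurableSet (A k)) {I : Set α} (hI : MeasurableSet I)
    (hcov : I ⊆ ⋃ k, A k)
    {f : α → ENNReal} {F : ℕ → α → ENNReal}
    (h : ∀ k, ∀ S ⊆ A k, S ⊆ I → MeasurableSet S →
      ∫⁻ x in S, f x ∂μ ≤ liminf (fun n => ∫⁻ x in S, F n x ∂μ) atTop) :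
    ∫⁻ x in I, f x ∂μ ≤ liminf (fun n => ∫⁻ x in I, F n x ∂μ) atTop := by
  rcases isEmpty_or_nonempty κ with hκ | hκ
  · have : I = ∅ := by simpa using hcov
    simp [this]
  obtain ⟨e, he⟩ := exists_surjective_nat κ
  -- Making the cover disjoint shrinks its members, which is why the hypothesis concerns all
  -- measurable subsets of `A k`.
  set B : ℕ → Set α := fun j => I ∩ disjointed (fun j => A (e j)) j with hB
  have hBm : ∀ j, MeasurableSet (B j) := fun j =>
    hI.inter (MeasurableSet.disjointed (fun j => hA (e j)) j)
  have hBd : Pairwise (Function.onFun Disjoint B) := fun i j hij =>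
    ((disjoint_disjointed _ hij).mono inter_subset_right inter_subset_right)
  have hBu : I = ⋃ j, B j := by
    rw [← inter_iUnion, iUnion_disjointed, he.iUnion_comp A]
    exact (inter_eq_left.2 hcov).symm
  have hsum : ∀ g : α → ENNReal, ∫⁻ x in I, g x ∂μ = ∑' j, ∫⁻ x in B j, g x ∂μ := by
    intro g
    conv_lhs => rw [hBu]
    exact lintegral_iUnion hBm hBd g
  simp only [hsum]
  -- The integrals over `I` are now series, and Fatou's lemma is applied to the counting measure on
  -- `ℕ`.
  simp only [← lintegral_count]
  refine le_trans (lintegral_mono fun j => ?_) (lintegral_liminf_le fun n => measurable_of_countable _)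
  exact h (e j) _ (inter_subset_right.trans (disjointed_subset _ _)) inter_subset_left (hBm j)

/-- Measurable selection of a maximal one among the first terms of a sequence of functions. -/
theorem exists_measurable_argmax {α : Type*} [MeasurableSpace α] {Φ : ℕ → α → ℝ}
    (hΦ : ∀ j, Measurable (Φ j)) (k : ℕ) :
    ∃ κ : α → ℕ, Measurable κ ∧ (∀ x, κ x ≤ k) ∧ ∀ x, ∀ j ≤ k, Φ j x ≤ Φ (κ x) x := by
  induction k with
  | zero => exact ⟨fun _ => 0, measurable_const, fun _ => le_rfl, fun x j hj => by
      rw [Nat.le_zero.1 hj]⟩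
  | succ k ih =>
    obtain ⟨κ, h1, h2, h3⟩ := ih
    have hm : Measurable fun x => Φ (κ x) x :=
      (measurable_from_prod_countable_right (f := fun p : ℕ × α => Φ p.1 p.2) hΦ).comp
        (h1.prodMk measurable_id)
    classical
    refine ⟨fun x => if Φ (κ x) x < Φ (k + 1) x then k + 1 else κ x,
      Measurable.ite (measurableSet_lt hm (hΦ _)) measurable_const h1, fun x => ?_,
      fun x j hj => ?_⟩
    · dsimp only
      split_ifs
      · exact le_rfl
      · exact (h2 x).trans (Nat.le_succ k)
    · dsimp only
      rcases Nat.lt_or_ge k j with hj' | hj'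
      · obtain rfl : j = k + 1 := by omega
        split_ifs with hlt
        · exact le_rfl
        · exact not_lt.1 hlt
      · split_ifs with hlt
        · exact (h3 x j hj').trans hlt.le
        · exact h3 x j hj'

theorem exists_aemeasurable_argmax {α : Type*} [MeasurableSpace α] {μ : Measure α} {Φ : ℕ → α → ℝ}
    (hΦ : ∀ j, AEMeasurable (Φ j) μ) (k : ℕ) :
    ∃ κ : α → ℕ, Measurable κ ∧ (∀ x, κ x ≤ k) ∧ ∀ᵐ x ∂μ, ∀ j ≤ k, Φ j x ≤ Φ (κ x) x := by
  obtain ⟨κ, h1, h2, h3⟩ := exists_measurable_argmax (fun j => (hΦ j).measurable_mk) k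
  refine ⟨κ, h1, h2, ?_⟩
  filter_upwards [ae_all_iff.2 fun j => (hΦ j).ae_eq_mk] with x hx j hj
  rw [hx, hx]
  exact h3 x j hj

/-- Lower semicontinuity from minorants whose integrals converge. -/
theorem lintegral_ofReal_le_liminf_of_minorant {α : Type*} [MeasurableSpace α] {μ : Measure α}
    [IsFiniteMeasure μ] {f u b : ℕ → α → ℝ} {u₀ b₀ : α → ℝ} {C : ℝ}
    (hu : ∀ n, Integrable (u n) μ) (hu₀ : Integrable u₀ μ)
    (hlim : Tendsto (fun n => ∫ x, u n x ∂μ) atTop (𝓝 (∫ x, u₀ x ∂μ)))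
    (hbm : ∀ n, AEStronglyMeasurable (b n) μ) (hbC : ∀ n, ∀ᵐ x ∂μ, |b n x| ≤ C)
    (hb : ∀ᵐ x ∂μ, Tendsto (fun n => b n x) atTop (𝓝 (b₀ x)))
    (hpos : ∀ᵐ x ∂μ, 0 ≤ u₀ x + b₀ x)
    (hle : ∀ᶠ n in atTop, ∀ᵐ x ∂μ, u n x + b n x ≤ f n x) :
    ∫⁻ x, ENNReal.ofReal (u₀ x + b₀ x) ∂μ ≤
      liminf (fun n => ∫⁻ x, ENNReal.ofReal (f n x) ∂μ) atTop := by
  have hbi : ∀ n, Integrable (b n) μ := fun n =>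
    Integrable.of_bound (hbm n) C (hbC n)
  have hb₀m : AEStronglyMeasurable b₀ μ := aestronglyMeasurable_of_tendsto_ae atTop hbm hb
  have hb₀i : Integrable b₀ μ := by
    refine Integrable.of_bound hb₀m C ?_
    filter_upwards [ae_all_iff.2 hbC, hb] with x hx hx'
    exact le_of_tendsto hx'.norm (Eventually.of_forall hx)
  have hbl : Tendsto (fun n => ∫ x, b n x ∂μ) atTop (𝓝 (∫ x, b₀ x ∂μ)) :=
    tendsto_integral_of_dominated_convergence (fun _ => C) hbm (integrable_const C) hbC hb
  have hl : Tendsto (fun n => ∫ x, (u n x + b n x) ∂μ) atTop (𝓝 (∫ x, (u₀ x + b₀ x) ∂μ)) := by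
    rw [integral_add hu₀ hb₀i]
    simp only [fun n => integral_add (hu n) (hbi n)]
    exact hlim.add hbl
  have hi : Integrable (fun x => u₀ x + b₀ x) μ := hu₀.add hb₀i
  -- Nonnegativity is needed only for the limit minorant; for each `n` the integral is at most that
  -- of its positive part.
  rw [← ofReal_integral_eq_lintegral_ofReal hi hpos, ← (ENNReal.tendsto_ofReal hl).liminf_eq]
  refine liminf_le_liminf ?_
  filter_upwards [hle] with n hn
  have hin : Integrable (fun x => u n x + b n x) μ := (hu n).add (hbi n)
  rw [integral_eq_lintegral_pos_part_sub_lintegral_neg_part hin]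
  refine ENNReal.ofReal_le_of_le_toReal ((sub_le_self _ ENNReal.toReal_nonneg).trans ?_) |>.trans
    (lintegral_mono_ae (hn.mono fun x hx => ENNReal.ofReal_le_ofReal hx))
  exact le_rfl

/-! ### Local structure of the geodesic distance -/

namespace Network

variable {N : ℕ} {ι : Type*}

theorem zero_mem_Icc_len (G : Network N ι) (i : ι) : (0 : ℝ) ∈ Icc 0 (G.len i) :=
  left_mem_Icc.2 (G.len_pos i).le

/-- An arc through an interior point of the arc `i` is, up to reparametrization, the arc `i`. -/
theorem exists_arc_eq_of_arc_eq (G : Network N ι) {i j : ι} {s a a' : ℝ}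
    (hs : s ∈ Ioo 0 (G.len i)) (ha : a ∈ Icc 0 (G.len j)) (ha' : a' ∈ Icc 0 (G.len j))
    (h : G.arc j a' = G.arc i s) :
    ∃ b ∈ Icc 0 (G.len i), G.arc j a = G.arc i b ∧ |b - s| = |a - a'| := by
  have hv := G.arc_not_mem_vertices hs
  have ha'' : a' ∈ Ioo 0 (G.len j) := by
    refine ⟨lt_of_le_of_ne ha'.1 fun h0 => hv ⟨j, Or.inl ?_⟩,
      lt_of_le_of_ne ha'.2 fun h0 => hv ⟨j, Or.inr ?_⟩⟩
    · rw [← h, ← h0]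
    · rw [← h, h0]
  rcases G.eq_or_rev_of_arc_eq hs ha'' h.symm with ⟨rfl, rfl⟩ | ⟨rfl, rfl⟩
  · exact ⟨a, ha, rfl, rfl⟩
  · rw [G.len_rev] at ha
    refine ⟨G.len i - a, ⟨by linarith [ha.2], by linarith [ha.1]⟩, G.arc_rev i a ha, ?_⟩
    rw [abs_sub_comm a]
    congr 1
    ring

/-- A route too short to reach either end of the arc stays in its interior, where every piece of a
route is, up to orientation, a piece of arc `i`. The induction runs backwards from the end of the
route. -/
theorem Route.exists_arc_eq {G : Network N ι} {y z : EuclideanSpace ℝ (Fin N)} {l : ℝ}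
    (h : G.Route y z l) {i : ι} {s : ℝ} (hs : s ∈ Icc 0 (G.len i)) (hz : z = G.arc i s)
    (hl : l < s) (hl' : l < G.len i - s) :
    ∃ s' ∈ Icc 0 (G.len i), y = G.arc i s' ∧ |s' - s| ≤ l := by
  induction h with
  | refl x => exact ⟨s, hs, hz, by simp⟩
  | step j a a' ha ha' z l hr ih =>
    have h0 := abs_nonneg (a - a')
    obtain ⟨s', hs', h1, h2⟩ := ih hz (by linarith) (by linarith)
    have h3 := abs_le.1 h2
    obtain ⟨b, hb, h4, h5⟩ := G.exists_arc_eq_of_arc_eq ⟨by linarith, by linarith⟩ ha ha' h1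
    refine ⟨b, hb, h4, ?_⟩
    have := abs_sub_le b s' s
    linarith

/-- The points near an interior point of an arc are on this arc. -/
theorem exists_arc_eq_of_dist_lt (G : Network N ι) {y z : G.Point} {i : ι} {s ε : ℝ}
    (hs : s ∈ Icc 0 (G.len i)) (hz : z.pos = G.arc i s) (hε : ε ≤ s) (hε' : ε ≤ G.len i - s)
    (hd : dist y z < ε) :
    ∃ s' ∈ Icc 0 (G.len i), y.pos = G.arc i s' ∧ |s' - s| < ε := by
  obtain ⟨l, hl, hlε⟩ := exists_lt_of_csInf_lt (G.exists_route y z) hd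
  obtain ⟨s', h1, h2, h3⟩ := Route.exists_arc_eq hl hs hz (by linarith) (by linarith)
  exact ⟨s', h1, h2, h3.trans_lt hlε⟩

theorem isOpen_arc_Ioo (G : Network N ι) {i : ι} {a b : ℝ} (ha : 0 ≤ a) (hb : b ≤ G.len i) :
    IsOpen {p : G.Point | ∃ s ∈ Ioo a b, p.pos = G.arc i s} := by
  rw [Metric.isOpen_iff]
  rintro z ⟨s, hs, hz⟩
  refine ⟨min (s - a) (b - s), lt_min (by linarith [hs.1]) (by linarith [hs.2]), fun y hy => ?_⟩
  have h1 := min_le_left (s - a) (b - s)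
  have h2 := min_le_right (s - a) (b - s)
  obtain ⟨s', -, h4, h5⟩ := G.exists_arc_eq_of_dist_lt (i := i) (s := s)
    ⟨by linarith [hs.1], by linarith [hs.2]⟩ hz (by linarith) (by linarith) (Metric.mem_ball.1 hy)
  have h6 := abs_lt.1 h5
  exact ⟨s', ⟨by linarith, by linarith⟩, h4⟩

/-- A route shorter than every arc, ending at `x`, cannot pass through to the far end of an arc
issuing from `x`. -/
theorem Route.exists_arc_eq_of_vertex {G : Network N ι} {δ : ℝ} (hδ : ∀ i, δ ≤ G.len i)
    {y x : EuclideanSpace ℝ (Fin N)} {l : ℝ} (h : G.Route y x l) (hx : x ∈ G.vertices)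
    (hl : l < δ) :
    ∃ i, ∃ s ∈ Icc 0 (G.len i), G.arc i 0 = x ∧ y = G.arc i s ∧ s ≤ l := by
  induction h with
  | refl x =>
    obtain ⟨i, rfl | rfl⟩ := hx
    · exact ⟨i, 0, G.zero_mem_Icc_len i, rfl, rfl, le_rfl⟩
    · have h0 : G.arc (G.rev i) 0 = G.arc i (G.len i) := by
        rw [G.arc_rev i 0 (G.zero_mem_Icc_len i), sub_zero]
      exact ⟨G.rev i, 0, G.zero_mem_Icc_len _, h0, h0.symm, le_rfl⟩
  | step j a a' ha ha' x l hr ih =>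
    have h0 := abs_nonneg (a - a')
    obtain ⟨i, s, hs, h1, h2, h3⟩ := ih hx (by linarith)
    -- If `s = 0` the current point is `x` itself, and the next piece lies on an arc starting there,
    -- possibly after reversal. If `s > 0` it is interior to arc `i`, since `s < δ`, and the next
    -- piece cannot leave that arc.
    rcases hs.1.eq_or_lt with h4 | h4
    · subst h4
      have h5 : a' = 0 ∨ a' = G.len j := by
        by_contra! hc
        refine G.arc_not_mem_vertices (i := j) (s := a') ⟨lt_of_le_of_ne ha'.1 hc.1.symm,
          lt_of_le_of_ne ha'.2 hc.2⟩ ?_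
        rw [h2]
        exact ⟨i, Or.inl rfl⟩
      rcases h5 with rfl | rfl
      · refine ⟨j, a, ha, h2.trans h1, rfl, ?_⟩
        rw [sub_zero, abs_of_nonneg ha.1]
        linarith
      · have hm : G.len j - a ∈ Icc 0 (G.len j) := ⟨by linarith [ha.2], by linarith [ha.1]⟩
        refine ⟨G.rev j, G.len j - a, by rwa [G.len_rev], ?_, ?_, ?_⟩
        · rw [G.arc_rev j 0 (G.zero_mem_Icc_len j), sub_zero]
          exact h2.trans h1
        · rw [G.arc_rev j _ hm, sub_sub_cancel]
        · rw [abs_sub_comm, abs_of_nonneg hm.1]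
          linarith
    · obtain ⟨b, hb, h5, h6⟩ := G.exists_arc_eq_of_arc_eq ⟨h4, by linarith [hδ i]⟩ ha ha' h2
      refine ⟨i, b, hb, h1, h5, ?_⟩
      have := le_abs_self (b - s)
      linarith

/-- The points near a vertex are on the arcs starting at this vertex. -/
theorem exists_arc_eq_of_dist_vertex_lt (G : Network N ι) {δ ε : ℝ} (hδ : ∀ i, δ ≤ G.len i)
    (hε : ε ≤ δ) {y x : G.Point} (hx : x.pos ∈ G.vertices) (hd : dist y x < ε) :
    ∃ i, ∃ s ∈ Icc 0 (G.len i), G.arc i 0 = x.pos ∧ y.pos = G.arc i s ∧ s < ε := by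
  obtain ⟨l, hl, hlε⟩ := exists_lt_of_csInf_lt (G.exists_route y x) hd
  obtain ⟨i, s, h1, h2, h3, h4⟩ := Route.exists_arc_eq_of_vertex hδ hl hx (by linarith)
  exact ⟨i, s, h1, h2, h3, h4.trans_lt hlε⟩

/-! ### Tent functions -/

open Classical in
/-- The function on the network which is `max 0 (r - |s - c|)` at the point with parameter `s` of
the arc `i`, and `0` off this arc. -/
noncomputable def tent (G : Network N ι) (i : ι) (c r : ℝ) (x : EuclideanSpace ℝ (Fin N)) : ℝ :=
  if h : ∃ s ∈ Ioo 0 (G.len i), x = G.arc i s then max 0 (r - |choose h - c|) else 0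

/-- The conditions on `c` and `r` put the support of the tent inside the arc, so the formula also
gives the value `0` at the two ends, even for a loop. -/
theorem tent_arc (G : Network N ι) {i : ι} {c r : ℝ} (hr : r ≤ c) (hr' : c + r ≤ G.len i)
    {s : ℝ} (hs : s ∈ Icc 0 (G.len i)) : G.tent i c r (G.arc i s) = max 0 (r - |s - c|) := by
  by_cases h : s ∈ Ioo 0 (G.len i)
  · have h' : ∃ s' ∈ Ioo 0 (G.len i), G.arc i s = G.arc i s' := ⟨s, h, rfl⟩
    have h1 := Classical.choose_spec h'
    have h2 : Classical.choose h' = s := by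
      rcases G.simple_arc i s hs _ (Ioo_subset_Icc_self h1.1) h1.2 with h3 | h3 | h3
      · exact h3.symm
      · exact absurd h3.1 h.1.ne'
      · exact absurd h3.1 h.2.ne
    rw [tent, dif_pos h', h2]
  · have h0 : s = 0 ∨ s = G.len i := by
      by_contra! hc
      exact h ⟨lt_of_le_of_ne hs.1 hc.1.symm, lt_of_le_of_ne hs.2 hc.2⟩
    have h' : ¬∃ s' ∈ Ioo 0 (G.len i), G.arc i s = G.arc i s' := by
      rintro ⟨s', hs', h1⟩
      refine G.arc_not_mem_vertices hs' (h1 ▸ ⟨i, ?_⟩)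
      rcases h0 with rfl | rfl
      · exact Or.inl rfl
      · exact Or.inr rfl
    rw [tent, dif_neg h', eq_comm, max_eq_left]
    rcases h0 with rfl | rfl
    · rw [zero_sub, abs_neg]
      linarith [le_abs_self c]
    · linarith [le_abs_self (G.len i - c)]

theorem tent_nonneg (G : Network N ι) (i : ι) (c r : ℝ) (x : EuclideanSpace ℝ (Fin N)) :
    0 ≤ G.tent i c r x := by
  unfold tent
  split_ifs
  · exact le_max_left _ _
  · exact le_rfl

theorem tent_eq_zero (G : Network N ι) {i : ι} {c r : ℝ} {x : EuclideanSpace ℝ (Fin N)}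
    (h : ∀ s ∈ Ioo 0 (G.len i), x ≠ G.arc i s) : G.tent i c r x = 0 := by
  rw [tent, dif_neg]
  rintro ⟨s, hs, h'⟩
  exact h s hs h'

theorem tent_of_mem_vertices (G : Network N ι) (i : ι) (c r : ℝ) {x : EuclideanSpace ℝ (Fin N)}
    (hx : x ∈ G.vertices) : G.tent i c r x = 0 :=
  G.tent_eq_zero fun _ hs h => G.arc_not_mem_vertices hs (h ▸ hx)

theorem tent_le (G : Network N ι) (i : ι) (c : ℝ) {r : ℝ} (hr : 0 ≤ r)
    (x : EuclideanSpace ℝ (Fin N)) : G.tent i c r x ≤ r := by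
  unfold tent
  split_ifs with h
  · exact max_le hr (by linarith [abs_nonneg (Classical.choose h - c)])
  · exact hr

theorem tent_pos (G : Network N ι) {i : ι} {c r : ℝ} (hr : r ≤ c) (hr' : c + r ≤ G.len i)
    {x : EuclideanSpace ℝ (Fin N)} (h : 0 < G.tent i c r x) :
    ∃ s ∈ Ioo (c - r) (c + r), x = G.arc i s ∧ G.tent i c r x = r - |s - c| := by
  have h1 : ∃ s ∈ Ioo 0 (G.len i), x = G.arc i s := by
    by_contra! hc
    exact h.ne' (G.tent_eq_zero hc)
  obtain ⟨s, hs, rfl⟩ := h1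
  rw [G.tent_arc hr hr' (Ioo_subset_Icc_self hs)] at h ⊢
  have h2 : 0 < r - |s - c| := by simpa using h
  have h3 := abs_lt.1 (sub_pos.1 h2)
  exact ⟨s, ⟨by linarith, by linarith⟩, rfl, max_eq_right h2.le⟩

/-- If either end of the piece is interior to arc `i`, the whole piece can be reparametrized on arc
`i`, where the tent is explicit; otherwise the tent vanishes at both ends. -/
theorem abs_tent_arc_sub_le (G : Network N ι) {i : ι} {c r : ℝ} (hr : r ≤ c)
    (hr' : c + r ≤ G.len i) {j : ι} {a a' : ℝ} (ha : a ∈ Icc 0 (G.len j))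
    (ha' : a' ∈ Icc 0 (G.len j)) :
    |G.tent i c r (G.arc j a) - G.tent i c r (G.arc j a')| ≤ |a - a'| := by
  by_cases h : (∀ s ∈ Ioo 0 (G.len i), G.arc j a' ≠ G.arc i s) ∧
      ∀ s ∈ Ioo 0 (G.len i), G.arc j a ≠ G.arc i s
  · rw [G.tent_eq_zero h.1, G.tent_eq_zero h.2, sub_zero, abs_zero]
    exact abs_nonneg _
  have key : ∀ {s b : ℝ}, s ∈ Icc 0 (G.len i) → b ∈ Icc 0 (G.len i) →
      |G.tent i c r (G.arc i b) - G.tent i c r (G.arc i s)| ≤ |b - s| := by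
    intro s b hs hb
    rw [G.tent_arc hr hr' hs, G.tent_arc hr hr' hb]
    refine (abs_max_sub_max_le_max _ _ _ _).trans ?_
    rw [sub_self, abs_zero, max_eq_right (abs_nonneg _)]
    calc |r - |b - c| - (r - |s - c|)| = |(|s - c|) - (|b - c|)| := by congr 1; ring
      _ ≤ |s - c - (b - c)| := abs_abs_sub_abs_le_abs_sub _ _
      _ = |b - s| := by rw [abs_sub_comm b]; congr 1; ring
  by_cases h1 : ∀ s ∈ Ioo 0 (G.len i), G.arc j a' ≠ G.arc i s
  · have h2 : ∃ s ∈ Ioo 0 (G.len i), G.arc j a = G.arc i s := by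
      by_contra! hc
      exact h ⟨h1, hc⟩
    obtain ⟨s, hs, h3⟩ := h2
    obtain ⟨b, hb, h4, h5⟩ := G.exists_arc_eq_of_arc_eq hs ha' ha h3
    rw [h3, h4, abs_sub_comm, abs_sub_comm a, ← h5]
    exact key (Ioo_subset_Icc_self hs) hb
  · push Not at h1
    obtain ⟨s, hs, h3⟩ := h1
    obtain ⟨b, hb, h4, h5⟩ := G.exists_arc_eq_of_arc_eq hs ha ha' h3
    rw [h3, h4, ← h5]
    exact key (Ioo_subset_Icc_self hs) hb

/-- The bound on single pieces adds up along routes. Through this property absolute continuity and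
uniform convergence with respect to `d_Γ` pass to real-valued functions. -/
theorem lipschitzWith_tent (G : Network N ι) {i : ι} {c r : ℝ} (hr : r ≤ c)
    (hr' : c + r ≤ G.len i) : LipschitzWith 1 fun p : G.Point => G.tent i c r p.pos := by
  refine LipschitzWith.of_dist_le_mul fun p p' => ?_
  rw [NNReal.coe_one, one_mul]
  have key : ∀ {x y : EuclideanSpace ℝ (Fin N)} {l : ℝ}, G.Route x y l →
      dist (G.tent i c r x) (G.tent i c r y) ≤ l := by
    intro x y l h
    induction h with
    | refl x => simp
    | step j a a' ha ha' y l _ ih =>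
      exact (dist_triangle _ _ _).trans (add_le_add (G.abs_tent_arc_sub_le hr hr' ha ha') ih)
  exact le_csInf (G.exists_route p p') fun l hl => key hl

/-! ### Derivatives of tent functions along curves -/

theorem norm_tangent (G : Network N ι) {i : ι} {s : ℝ} (hs : s ∈ Icc 0 (G.len i)) :
    ‖G.tangent i s‖ = 1 := G.norm_deriv_arc i s hs

/-- The chain rule for a curve which is locally `τ ↦ γ_i (a + e g(τ))`. -/
theorem hasDerivAt_of_eventually_eq_arc (G : Network N ι) {i : ι} {a e : ℝ} {g : ℝ → ℝ}
    {x : ℝ → EuclideanSpace ℝ (Fin N)} {τ g' : ℝ} (hg : HasDerivAt g g' τ)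
    (hτ : a + e * g τ ∈ Ioo 0 (G.len i)) (hx : ∀ᶠ r in 𝓝 τ, x r = G.arc i (a + e * g r)) :
    HasDerivAt x ((e * g') • G.tangent i (a + e * g τ)) τ := by
  have h1 : HasDerivAt (G.arc i) (G.tangent i (a + e * g τ)) (a + e * g τ) :=
    (((G.contDiffOn_arc i).differentiableOn one_ne_zero _
      (Ioo_subset_Icc_self hτ)).hasDerivWithinAt).hasDerivAt (Icc_mem_nhds hτ.1 hτ.2)
  exact (h1.scomp τ ((hg.const_mul e).const_add a)).congr_of_eventuallyEq hx

/-- On the ascending part of a tent, the curve is parametrized by the tent function. -/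
theorem hasDerivAt_pos_of_mem_ascending (G : Network N ι) {i : ι} {c r : ℝ} (hr : r ≤ c)
    (hr' : c + r ≤ G.len i) {ξ : ℝ → G.Point} {τ s : ℝ} (hξ : ContinuousAt ξ τ)
    (hs : s ∈ Ioo (c - r) c) (hτ : (ξ τ).pos = G.arc i s)
    (hd : DifferentiableAt ℝ (fun t => G.tent i c r (ξ t).pos) τ) :
    HasDerivAt (fun t => (ξ t).pos)
      (deriv (fun t => G.tent i c r (ξ t).pos) τ • G.tangent i s) τ := by
  have hval : ∀ {s'}, s' ∈ Ioo (c - r) c → (c - r) + 1 * G.tent i c r (G.arc i s') = s' := by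
    intro s' hs'
    rw [G.tent_arc hr hr' ⟨by linarith [hs'.1], by linarith [hs'.1, hs'.2]⟩,
      abs_of_nonpos (by linarith [hs'.2]), max_eq_right (by linarith [hs'.1])]
    ring
  have hev : ∀ᶠ t in 𝓝 τ, (ξ t).pos = G.arc i ((c - r) + 1 * G.tent i c r (ξ t).pos) := by
    have ho := G.isOpen_arc_Ioo (i := i) (a := c - r) (b := c) (by linarith)
      (by linarith [hs.1, hs.2])
    filter_upwards [hξ.eventually (ho.mem_nhds ⟨s, hs, hτ⟩)] with t ht
    obtain ⟨s', hs', h⟩ := ht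
    rw [h, hval hs']
  have hsτ : (c - r) + 1 * G.tent i c r (ξ τ).pos = s := by rw [hτ, hval hs]
  have h := G.hasDerivAt_of_eventually_eq_arc hd.hasDerivAt (i := i) (a := c - r) (e := 1)
    (by rw [hsτ]; exact ⟨by linarith [hs.1], by linarith [hs.1, hs.2]⟩) hev
  rwa [hsτ, one_mul] at h

theorem inner_deriv_pos_tangent (G : Network N ι) {i : ι} {c r : ℝ} (hr : r ≤ c)
    (hr' : c + r ≤ G.len i) {ξ : ℝ → G.Point} {τ s : ℝ} (hξ : ContinuousAt ξ τ)
    (hs : s ∈ Ioo (c - r) c) (hτ : (ξ τ).pos = G.arc i s)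
    (hd : DifferentiableAt ℝ (fun t => G.tent i c r (ξ t).pos) τ) :
    inner ℝ (deriv (fun t => (ξ t).pos) τ) (G.tangent i s) =
      deriv (fun t => G.tent i c r (ξ t).pos) τ := by
  rw [(G.hasDerivAt_pos_of_mem_ascending hr hr' hξ hs hτ hd).deriv, real_inner_smul_left,
    real_inner_self_eq_norm_sq, G.norm_tangent ⟨by linarith [hs.1], by linarith [hs.1, hs.2]⟩]
  simp

/-- Such a time is a global minimum of a nonnegative function. -/
theorem deriv_tent_eq_zero (G : Network N ι) {i : ι} {c r : ℝ} {ξ : ℝ → G.Point} {τ : ℝ}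
    (h : G.tent i c r (ξ τ).pos = 0) : deriv (fun t => G.tent i c r (ξ t).pos) τ = 0 := by
  refine IsLocalMin.deriv_eq_zero (Eventually.of_forall fun t => ?_)
  change G.tent i c r (ξ τ).pos ≤ _
  rw [h]
  exact G.tent_nonneg _ _ _ _

/-- Where the tent vanishes or peaks its derivative along the curve is `0`. On either slope the
curve is locally the arc evaluated at an affine function of slope `±1` of the tent, so
differentiability of the tent along the curve gives that of the curve, with equal norms. -/
theorem norm_deriv_tent_le (G : Network N ι) {i : ι} {c r : ℝ} (hr : r ≤ c)
    (hr' : c + r ≤ G.len i) {ξ : ℝ → G.Point} {τ : ℝ} (hξ : ContinuousAt ξ τ) :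
    ‖deriv (fun t => G.tent i c r (ξ t).pos) τ‖ ≤ ‖deriv (fun t => (ξ t).pos) τ‖ := by
  by_cases h0 : deriv (fun t => G.tent i c r (ξ t).pos) τ = 0
  · rw [h0, norm_zero]
    exact norm_nonneg _
  have hd : DifferentiableAt ℝ (fun t => G.tent i c r (ξ t).pos) τ := by
    by_contra h
    exact h0 (deriv_zero_of_not_differentiableAt h)
  have hpos : 0 < G.tent i c r (ξ τ).pos :=
    lt_of_le_of_ne (G.tent_nonneg _ _ _ _) fun h => h0 (G.deriv_tent_eq_zero h.symm)
  obtain ⟨s, hs, hτ, hval⟩ := G.tent_pos hr hr' hpos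
  have hsm : s ∈ Ioo 0 (G.len i) := ⟨by linarith [hs.1], by linarith [hs.2]⟩
  rcases lt_trichotomy s c with h | h | h
  · rw [(G.hasDerivAt_pos_of_mem_ascending hr hr' hξ ⟨hs.1, h⟩ hτ hd).deriv, norm_smul,
      G.norm_tangent (Ioo_subset_Icc_self hsm), mul_one]
  · refine absurd (IsLocalMax.deriv_eq_zero (Eventually.of_forall fun t => ?_)) h0
    change _ ≤ G.tent i c r (ξ τ).pos
    rw [hval, h, sub_self, abs_zero, sub_zero]
    exact G.tent_le _ _ (by linarith [hs.1, hs.2]) _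
  · have hval' : ∀ {s'}, s' ∈ Ioo c (c + r) → (c + r) + -1 * G.tent i c r (G.arc i s') = s' := by
      intro s' hs'
      rw [G.tent_arc hr hr' ⟨by linarith [hs'.1, hs'.2], by linarith [hs'.1, hs'.2]⟩,
        abs_of_nonneg (by linarith [hs'.1]), max_eq_right (by linarith [hs'.2])]
      ring
    have hev : ∀ᶠ t in 𝓝 τ, (ξ t).pos = G.arc i ((c + r) + -1 * G.tent i c r (ξ t).pos) := by
      have ho := G.isOpen_arc_Ioo (i := i) (a := c) (b := c + r)
        (by linarith [hs.1, hs.2]) (by linarith)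
      filter_upwards [hξ.eventually (ho.mem_nhds ⟨s, ⟨h, hs.2⟩, hτ⟩)] with t ht
      obtain ⟨s', hs', h'⟩ := ht
      rw [h', hval' hs']
    have hsτ : (c + r) + -1 * G.tent i c r (ξ τ).pos = s := by rw [hτ, hval' ⟨h, hs.2⟩]
    have h := G.hasDerivAt_of_eventually_eq_arc hd.hasDerivAt (i := i) (a := c + r) (e := -1)
      (by rwa [hsτ]) hev
    rw [h.deriv, hsτ, norm_smul, G.norm_tangent (Ioo_subset_Icc_self hsm), mul_one, neg_one_mul,
      norm_neg]

end Network

/-! ### Superlinear growth and the Lagrangian as a countable supremum -/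

theorem IsSuperlinearGauge.bddAbove_mul_sub {θ : ℝ → ℝ} (hθ : IsSuperlinearGauge θ) (v : ℝ) :
    ∃ B, ∀ μ : ℝ, v * μ - θ |μ| ≤ B := by
  obtain ⟨R, hR⟩ := eventually_atTop.1 (hθ.superlinear.eventually_ge_atTop |v|)
  -- Beyond `max R 1` the gauge dominates `|v| * |μ|`; the `1` keeps `|μ|` positive for the
  -- division.
  refine ⟨|v| * max R 1 + |θ 0|, fun μ => ?_⟩
  have h1 : v * μ ≤ |v| * |μ| := by
    rw [← abs_mul]
    exact le_abs_self _
  have h2 : θ 0 ≤ θ |μ| := hθ.monotoneOn self_mem_Ici (abs_nonneg μ) (abs_nonneg μ)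
  have h3 := neg_abs_le (θ 0)
  rcases le_total |μ| (max R 1) with h | h
  · have := mul_le_mul_of_nonneg_left h (abs_nonneg v)
    linarith
  · have h4 : 0 < |μ| := one_pos.trans_le ((le_max_right R 1).trans h)
    have h5 := (le_div_iff₀ h4).1 (hR |μ| ((le_max_left R 1).trans h))
    have h6 : 0 ≤ |v| * max R 1 := mul_nonneg (abs_nonneg v) (zero_le_one.trans (le_max_right R 1))
    linarith [abs_nonneg (θ 0)]

/-- A dense sequence of reals starting at `0`. -/
theorem exists_denseRange_zero : ∃ q : ℕ → ℝ, DenseRange q ∧ q 0 = 0 := by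
  -- With `0` as first term, a maximal choice among the first terms is never worse than zero
  -- momentum, whose value `-H(·,·,0)` is bounded below.
  refine ⟨fun n => Nat.casesOn n 0 (TopologicalSpace.denseSeq ℝ), ?_, rfl⟩
  refine (TopologicalSpace.denseRange_denseSeq ℝ).mono ?_
  rintro _ ⟨n, rfl⟩
  exact ⟨n + 1, rfl⟩

/-- The curves are controlled only on `[t₁, t₂]`, so two-sided continuity and derivatives make sense
only at interior times. -/
theorem ae_restrict_Icc_mem_Ioo (a b : ℝ) : ∀ᵐ τ ∂volume.restrict (Icc a b), τ ∈ Ioo a b := by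
  have h : volume.restrict (Icc a b) = volume.restrict (Ioo a b) :=
    Measure.restrict_congr_set Ioo_ae_eq_Icc.symm
  rw [h]
  exact ae_restrict_mem measurableSet_Ioo

theorem AbsolutelyContinuousOnInterval.continuousOn_Icc {X : Type*} [PseudoMetricSpace X]
    {f : ℝ → X} {a b : ℝ} (hf : AbsolutelyContinuousOnInterval f a b) :
    ContinuousOn f (Icc a b) := by
  rw [Metric.continuousOn_iff]
  intro y hy ε hε
  obtain ⟨δ, hδ, h⟩ := (absolutelyContinuousOnInterval_iff f a b).1 hf ε hε
  refine ⟨δ, hδ, fun x hx hxy => ?_⟩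
  simpa using h (1, fun _ => (x, y))
    (by
      refine ⟨fun i _ => ⟨Icc_subset_uIcc hx, Icc_subset_uIcc hy⟩, ?_⟩
      intro i hi j hj hij
      simp only [Finset.coe_range, mem_Iio, Nat.lt_one_iff] at hi hj
      exact absurd (hi.trans hj.symm) hij) (by simpa using hxy)

theorem AbsolutelyContinuousOnInterval.continuousAt_of_mem_Ioo {X : Type*} [PseudoMetricSpace X]
    {f : ℝ → X} {a b τ : ℝ} (hf : AbsolutelyContinuousOnInterval f a b) (hτ : τ ∈ Ioo a b) :
    ContinuousAt f τ :=
  hf.continuousOn_Icc.continuousAt (Icc_mem_nhds hτ.1 hτ.2)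

namespace NetworkHamiltonian

variable {N : ℕ} {ι : Type*} {G : Network N ι}

theorem bddAbove_range (𝓗 : NetworkHamiltonian G) {i : ι} {s t : ℝ} (hs : s ∈ Icc 0 (G.len i))
    (ht : 0 ≤ t) (v : ℝ) : BddAbove (range fun μ => v * μ - 𝓗.H i s t μ) := by
  obtain ⟨θ, Θ, hθ, -, h⟩ := 𝓗.coercive (t + 1) (by linarith)
  obtain ⟨B, hB⟩ := hθ.bddAbove_mul_sub v
  refine ⟨B, ?_⟩
  rintro _ ⟨μ, rfl⟩
  have := (h i s hs t ⟨ht, by linarith⟩ μ).1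
  linarith [hB μ]

theorem le_arcLagrangian (𝓗 : NetworkHamiltonian G) {i : ι} {s t : ℝ} (hs : s ∈ Icc 0 (G.len i))
    (ht : 0 ≤ t) (v μ : ℝ) : v * μ - 𝓗.H i s t μ ≤ 𝓗.arcLagrangian i s v t :=
  le_ciSup (𝓗.bddAbove_range hs ht v) μ

theorem exists_abs_le (𝓗 : NetworkHamiltonian G) {T : ℝ} (hT : 0 < T) (R : ℝ) :
    ∃ C, ∀ i, ∀ s ∈ Icc 0 (G.len i), ∀ t ∈ Icc 0 T, ∀ μ, |μ| ≤ R → |𝓗.H i s t μ| ≤ C := by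
  obtain ⟨θ, Θ, hθ, hΘ, h⟩ := 𝓗.coercive T hT
  refine ⟨|θ 0| + |Θ R|, fun i s hs t ht μ hμ => abs_le.2 ?_⟩
  obtain ⟨h1, h2⟩ := h i s hs t ht μ
  have h3 : θ 0 ≤ θ |μ| := hθ.monotoneOn self_mem_Ici (abs_nonneg μ) (abs_nonneg μ)
  have h4 : Θ |μ| ≤ Θ R := hΘ.monotoneOn (abs_nonneg μ) ((abs_nonneg μ).trans hμ) hμ
  constructor
  · linarith [neg_abs_le (θ 0), abs_nonneg (Θ R)]
  · linarith [le_abs_self (Θ R), abs_nonneg (θ 0)]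

/-- The Hamiltonian of an arc extends continuously to all positions and times. -/
theorem exists_continuous_extension (𝓗 : NetworkHamiltonian G) (i : ι) :
    ∃ Hc : ℝ × ℝ × ℝ → ℝ, Continuous Hc ∧
      ∀ s ∈ Icc 0 (G.len i), ∀ t, 0 ≤ t → ∀ μ, Hc (s, t, μ) = 𝓗.H i s t μ := by
  refine ⟨fun p => 𝓗.H i (max 0 (min p.1 (G.len i))) (max p.2.1 0) p.2.2, ?_, ?_⟩
  · refine (𝓗.continuousOn i).comp_continuous
      (f := fun p : ℝ × ℝ × ℝ => (max 0 (min p.1 (G.len i)), max p.2.1 0, p.2.2))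
      (by fun_prop) fun p => ?_
    exact ⟨⟨le_max_left _ _, max_le (G.len_pos i).le (min_le_right _ _)⟩,
      mem_Ici.2 (le_max_right _ _), mem_univ _⟩
  · intro s hs t ht μ
    simp only [min_eq_left hs.2, max_eq_right hs.1, max_eq_left ht]

theorem continuous_H (𝓗 : NetworkHamiltonian G) {i : ι} {s t : ℝ} (hs : s ∈ Icc 0 (G.len i))
    (ht : 0 ≤ t) : Continuous (𝓗.H i s t) := by
  obtain ⟨Hc, h1, h2⟩ := 𝓗.exists_continuous_extension i
  have : 𝓗.H i s t = fun μ => Hc (s, t, μ) := by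
    ext μ
    rw [h2 s hs t ht]
  rw [this]
  fun_prop

/-- Continuity of `H` in `μ` reduces the supremum to countably many momenta, as measurability and
selection require. -/
theorem arcLagrangian_eq_iSup_dense (𝓗 : NetworkHamiltonian G) {i : ι} {s t : ℝ}
    (hs : s ∈ Icc 0 (G.len i)) (ht : 0 ≤ t) (v : ℝ) {q : ℕ → ℝ} (hq : DenseRange q) :
    𝓗.arcLagrangian i s v t = ⨆ j, (v * q j - 𝓗.H i s t (q j)) := by
  have hb : BddAbove (range fun j => v * q j - 𝓗.H i s t (q j)) :=
    (𝓗.bddAbove_range hs ht v).mono (range_comp_subset_range q fun μ => v * μ - 𝓗.H i s t μ)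
  refine le_antisymm (ciSup_le fun μ => ?_) (ciSup_le fun j => 𝓗.le_arcLagrangian hs ht v _)
  have hc := 𝓗.continuous_H hs ht
  refine hq.induction_on (p := fun μ => v * μ - 𝓗.H i s t μ ≤ _) μ
    (isClosed_le (by fun_prop) continuous_const) fun j => ?_
  exact le_ciSup hb j

/-- The Lagrangian is the limit of the maxima over the first terms of a dense sequence. -/
theorem tendsto_arcLagrangian (𝓗 : NetworkHamiltonian G) {i : ι} {s t : ℝ}
    (hs : s ∈ Icc 0 (G.len i)) (ht : 0 ≤ t) (v : ℝ) {q : ℕ → ℝ} (hq : DenseRange q) {κ : ℕ → ℕ}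
    (hκ : ∀ k, ∀ j ≤ k, v * q j - 𝓗.H i s t (q j) ≤ v * q (κ k) - 𝓗.H i s t (q (κ k))) :
    Tendsto (fun k => v * q (κ k) - 𝓗.H i s t (q (κ k))) atTop (𝓝 (𝓗.arcLagrangian i s v t)) := by
  refine tendsto_order.2 ⟨fun a ha => ?_, fun a ha => Eventually.of_forall fun k =>
    (𝓗.le_arcLagrangian hs ht v _).trans_lt ha⟩
  rw [𝓗.arcLagrangian_eq_iSup_dense hs ht v hq] at ha
  obtain ⟨j, hj⟩ := exists_lt_of_lt_ciSup ha
  filter_upwards [eventually_ge_atTop j] with k hk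
  exact hj.trans_le (hκ k j hk)

end NetworkHamiltonian

/-! ### Lower bounds and the integrand in tent coordinates -/

namespace FluxLimiter

variable {N : ℕ} {ι : Type*} {G : Network N ι} {𝓗 : NetworkHamiltonian G}

/-- Uniform lower bounds of the flux limiter, of `-H(⬝, ⬝, 0)` and of the overall Lagrangian. -/
theorem exists_lower_bound (F : FluxLimiter 𝓗) {T : ℝ} (hT : 0 < T) :
    ∃ K, 0 ≤ K ∧ (∀ x ∈ G.vertices, ∀ t ∈ Icc 0 T, |F.c x t| ≤ K) ∧
      (∀ i, ∀ s ∈ Icc 0 (G.len i), ∀ t ∈ Icc 0 T, 𝓗.H i s t 0 ≤ K) ∧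
      ∀ x q, ∀ t ∈ Icc 0 T, -K ≤ F.lagrangian x q t := by
  obtain ⟨C, hC⟩ := 𝓗.exists_abs_le hT 0
  obtain ⟨D, hD⟩ := F.bounded T hT
  have h1 : ∀ x ∈ G.vertices, ∀ t ∈ Icc 0 T, |F.c x t| ≤ |C| + |D| := fun x hx t ht =>
    (hD x hx t ht).trans ((le_abs_self D).trans (by linarith [abs_nonneg C]))
  have h2 : ∀ i, ∀ s ∈ Icc 0 (G.len i), ∀ t ∈ Icc 0 T, 𝓗.H i s t 0 ≤ |C| + |D| :=
    fun i s hs t ht => (le_abs_self _).trans ((hC i s hs t ht 0 (by simp)).trans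
      ((le_abs_self C).trans (by linarith [abs_nonneg D])))
  refine ⟨|C| + |D|, by positivity, h1, h2, fun x q t ht => ?_⟩
  by_cases hx : x.pos ∈ G.vertices
  · rw [F.lagrangian_of_mem_vertices x q t hx]
    have := (abs_le.1 (h1 _ hx t ht)).1
    have := sq_nonneg ‖q‖
    linarith
  · obtain ⟨⟨i, s⟩, hs, h⟩ := G.exists_interior_of_not_mem_vertices x hx
    rw [F.lagrangian_of_mem_Ioo x q ht.1 hs h]
    have h3 := 𝓗.le_arcLagrangian (Ioo_subset_Icc_self hs) ht.1 (inner ℝ q (G.tangent i s)) 0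
    have h4 := h2 i s (Ioo_subset_Icc_self hs) t ht
    simp only [mul_zero, zero_sub] at h3
    linarith

/-- On the ascending part of a tent, the integrand is the Lagrangian of the arc in terms of the
tent function. -/
theorem ae_integrand_eq (F : FluxLimiter 𝓗) {i : ι} {c r : ℝ} (hr : r ≤ c)
    (hr' : c + r ≤ G.len i) {t₁ t₂ : ℝ} (ht₁ : 0 ≤ t₁) {ξ : ℝ → G.Point}
    (hξ : AbsolutelyContinuousOnInterval ξ t₁ t₂) :
    ∀ᵐ τ ∂volume.restrict (Icc t₁ t₂), (∃ s ∈ Ioo (c - r) c, (ξ τ).pos = G.arc i s) →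
      F.integrand ξ τ = 𝓗.arcLagrangian i (c - r + G.tent i c r (ξ τ).pos)
        (deriv (fun t => G.tent i c r (ξ t).pos) τ) τ := by
  have hg : AbsolutelyContinuousOnInterval (fun t => G.tent i c r (ξ t).pos) t₁ t₂ :=
    (G.lipschitzWith_tent hr hr').comp_absolutelyContinuousOnInterval hξ
  filter_upwards [ae_restrict_Icc_mem_Ioo t₁ t₂,
    ae_restrict_of_ae hg.ae_differentiableAt] with τ hτ hd ⟨s, hs, h⟩
  have hτ' : τ ∈ uIcc t₁ t₂ := by
    rw [uIcc_of_le (hτ.1.trans hτ.2).le]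
    exact Ioo_subset_Icc_self hτ
  have hc := hξ.continuousAt_of_mem_Ioo hτ
  have hsm : s ∈ Ioo 0 (G.len i) := ⟨by linarith [hs.1], by linarith [hs.1, hs.2]⟩
  have hval : c - r + G.tent i c r (ξ τ).pos = s := by
    rw [h, G.tent_arc hr hr' (Ioo_subset_Icc_self hsm), abs_of_nonpos (by linarith [hs.2]),
      max_eq_right (by linarith [hs.1])]
    ring
  rw [integrand, F.lagrangian_of_mem_Ioo _ _ (ht₁.trans hτ.1.le) hsm h.symm, hval,
    G.inner_deriv_pos_tangent hr hr' hc hs h (hd hτ')]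

end FluxLimiter

/-! ### Tent functions along converging curves -/

namespace Network

variable {N : ℕ} {ι : Type*}

theorem eLpNorm_deriv_tent_le (G : Network N ι) {i : ι} {c r : ℝ} (hr : r ≤ c)
    (hr' : c + r ≤ G.len i) {t₁ t₂ : ℝ} {ξ : ℝ → G.Point}
    (hξ : AbsolutelyContinuousOnInterval ξ t₁ t₂) :
    eLpNorm (deriv fun t => G.tent i c r (ξ t).pos) 2 (volume.restrict (Icc t₁ t₂)) ≤
      eLpNorm (deriv fun t => (ξ t).pos) 2 (volume.restrict (Icc t₁ t₂)) := by
  refine eLpNorm_mono_ae ?_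
  filter_upwards [ae_restrict_Icc_mem_Ioo t₁ t₂] with τ hτ
  exact G.norm_deriv_tent_le hr hr' (hξ.continuousAt_of_mem_Ioo hτ)

/-- Weak convergence of the derivatives of tent functions along uniformly converging curves. -/
theorem tendsto_setIntegral_deriv_tent_mul (G : Network N ι) {i : ι} {c r : ℝ} (hr : r ≤ c)
    (hr' : c + r ≤ G.len i) {t₁ t₂ : ℝ} (ht : t₁ ≤ t₂) {ξ : ℕ → ℝ → G.Point} {ζ : ℝ → G.Point}
    (hξ : ∀ n, AbsolutelyContinuousOnInterval (ξ n) t₁ t₂)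
    (hζ : AbsolutelyContinuousOnInterval ζ t₁ t₂)
    (hunif : TendstoUniformlyOn ξ ζ atTop (Icc t₁ t₂)) {M : NNReal}
    (hξM : ∀ n, eLpNorm (deriv fun t => (ξ n t).pos) 2 (volume.restrict (Icc t₁ t₂)) ≤ M)
    (hζM : eLpNorm (deriv fun t => (ζ t).pos) 2 (volume.restrict (Icc t₁ t₂)) ≤ M)
    {S : Set ℝ} (hS : MeasurableSet S) (hSI : S ⊆ Icc t₁ t₂) {φ : ℝ → ℝ} (hφ : Measurable φ)
    {R : ℝ} (hφR : ∀ τ, |φ τ| ≤ R) :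
    Tendsto (fun n => ∫ τ in S, φ τ * deriv (fun t => G.tent i c r (ξ n t).pos) τ) atTop
      (𝓝 (∫ τ in S, φ τ * deriv (fun t => G.tent i c r (ζ t).pos) τ)) := by
  -- Restriction to `S` is absorbed into the test function, so that weak convergence is used on the
  -- whole interval.
  have hφ2 : MemLp (S.indicator φ) 2 (volume.restrict (Icc t₁ t₂)) := by
    refine MemLp.of_bound (hφ.indicator hS).aestronglyMeasurable R (ae_of_all _ fun τ => ?_)
    exact (norm_indicator_le_norm_self φ τ).trans (hφR τ)
  have hlip := G.lipschitzWith_tent hr hr'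
  have h := tendsto_integral_mul_deriv ht
    (fun n => hlip.comp_absolutelyContinuousOnInterval (hξ n))
    (hlip.comp_absolutelyContinuousOnInterval hζ)
    (hlip.uniformContinuous.comp_tendstoUniformlyOn hunif)
    (fun n => (G.eLpNorm_deriv_tent_le hr hr' (hξ n)).trans (hξM n))
    ((G.eLpNorm_deriv_tent_le hr hr' hζ).trans hζM) hφ2
  have hrw : ∀ u : ℝ → ℝ, ∫ τ in Icc t₁ t₂, S.indicator φ τ * u τ = ∫ τ in S, φ τ * u τ := by
    intro u
    have : (fun τ => S.indicator φ τ * u τ) = S.indicator fun τ => φ τ * u τ := by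
      ext τ
      by_cases hτ : τ ∈ S <;> simp [hτ]
    rw [this, setIntegral_indicator hS, inter_eq_right.2 hSI]
  simpa only [hrw] using h

theorem integrableOn_mul_deriv_tent (G : Network N ι) {i : ι} {c r : ℝ} (hr : r ≤ c)
    (hr' : c + r ≤ G.len i) {t₁ t₂ : ℝ} (ht : t₁ ≤ t₂) {ξ : ℝ → G.Point}
    (hξ : AbsolutelyContinuousOnInterval ξ t₁ t₂) {S : Set ℝ} (hSI : S ⊆ Icc t₁ t₂) {φ : ℝ → ℝ}
    (hφ : Measurable φ) {R : ℝ} (hφR : ∀ τ, |φ τ| ≤ R) :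
    IntegrableOn (fun τ => φ τ * deriv (fun t => G.tent i c r (ξ t).pos) τ) S := by
  have h := ((G.lipschitzWith_tent hr hr').comp_absolutelyContinuousOnInterval
    hξ).intervalIntegrable_deriv
  rw [intervalIntegrable_iff_integrableOn_Icc_of_le ht] at h
  exact (Integrable.bdd_mul h hφ.aestronglyMeasurable (ae_of_all _ hφR)).mono_measure
    (Measure.restrict_mono hSI le_rfl)

end Network

/-- A momentum selected among finitely many values is bounded, which makes it an admissible test
function and bounds the Hamiltonian at it. -/
theorem abs_comp_le_sum {α : Type*} (q : ℕ → ℝ) {κ : α → ℕ} {k : ℕ} (hκ : ∀ x, κ x ≤ k) (x : α) :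
    |q (κ x)| ≤ ∑ j ∈ Finset.range (k + 1), |q j| :=
  Finset.single_le_sum (f := fun j => |q j|) (fun j _ => abs_nonneg (q j))
    (Finset.mem_range.2 (Nat.lt_succ_of_le (hκ x)))

theorem Finset.aemeasurable_inf'_apply {α κ : Type*} [MeasurableSpace α] {μ : Measure α}
    {E : Finset κ} (hE : E.Nonempty) {f : κ → α → ℝ} (hf : ∀ i ∈ E, AEMeasurable (f i) μ) :
    AEMeasurable (fun x => E.inf' hE fun i => f i x) μ := by
  induction hE using Finset.Nonempty.cons_induction with
  | singleton a => simpa using hf a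
  | cons a s h hs ih =>
    simp only [Finset.inf'_cons hs]
    exact (hf a (by simp)).inf (ih fun i hi => hf i (by simp [hi]))

namespace Network

variable {N : ℕ} {ι : Type*}

theorem aemeasurable_tent (G : Network N ι) {i : ι} {c r : ℝ} (hr : r ≤ c)
    (hr' : c + r ≤ G.len i) {t₁ t₂ : ℝ} {ξ : ℝ → G.Point}
    (hξ : AbsolutelyContinuousOnInterval ξ t₁ t₂) {S : Set ℝ} (hSI : S ⊆ Icc t₁ t₂) :
    AEMeasurable (fun t => G.tent i c r (ξ t).pos) (volume.restrict S) :=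
  (((G.lipschitzWith_tent hr hr').continuous.comp_continuousOn hξ.continuousOn_Icc).aemeasurable
    measurableSet_Icc).mono_measure (Measure.restrict_mono hSI le_rfl)

end Network

/-! ### Lower semicontinuity on arcs and at vertices -/

namespace FluxLimiter

variable {N : ℕ} {ι : Type*} {G : Network N ι} {𝓗 : NetworkHamiltonian G}

/-- Lower semicontinuity on a set of times at which the limit curve is in the interior of an arc. -/
theorem lintegral_le_liminf_of_arc (F : FluxLimiter 𝓗) {i : ι} {c r : ℝ} (hr : r ≤ c)
    (hr' : c + r ≤ G.len i) {t₁ t₂ T K : ℝ} (ht₁ : 0 ≤ t₁) (ht : t₁ ≤ t₂) (hT : 0 < T)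
    (ht₂ : t₂ ≤ T) (hK : ∀ i, ∀ s ∈ Icc 0 (G.len i), ∀ t ∈ Icc 0 T, 𝓗.H i s t 0 ≤ K)
    {ξ : ℕ → ℝ → G.Point} {ζ : ℝ → G.Point}
    (hξ : ∀ n, AbsolutelyContinuousOnInterval (ξ n) t₁ t₂)
    (hζ : AbsolutelyContinuousOnInterval ζ t₁ t₂)
    (hunif : TendstoUniformlyOn ξ ζ atTop (Icc t₁ t₂)) {M : NNReal}
    (hξM : ∀ n, eLpNorm (deriv fun t => (ξ n t).pos) 2 (volume.restrict (Icc t₁ t₂)) ≤ M)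
    (hζM : eLpNorm (deriv fun t => (ζ t).pos) 2 (volume.restrict (Icc t₁ t₂)) ≤ M)
    {S : Set ℝ} (hS : MeasurableSet S) (hSI : S ⊆ Icc t₁ t₂) {ε : ℝ} (hε : 0 < ε)
    (hSζ : ∀ τ ∈ S, ∃ s ∈ Ioo (c - r + ε) (c - ε), (ζ τ).pos = G.arc i s) :
    ∫⁻ τ in S, ENNReal.ofReal (F.integrand ζ τ + K) ≤
      liminf (fun n => ∫⁻ τ in S, ENNReal.ofReal (F.integrand (ξ n) τ + K)) atTop := by
  rcases S.eq_empty_or_nonempty with rfl | ⟨τ₀, hτ₀⟩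
  · simp
  have hr0 : 0 ≤ r := by
    obtain ⟨s, hs, -⟩ := hSζ τ₀ hτ₀
    linarith [hs.1, hs.2]
  have : IsFiniteMeasure (volume.restrict S) := ⟨by
    rw [Measure.restrict_apply_univ]
    exact (measure_mono hSI).trans_lt measure_Icc_lt_top⟩
  have hsub : ∀ τ ∈ S, τ ∈ Icc 0 T := fun τ hτ =>
    ⟨ht₁.trans (hSI hτ).1, (hSI hτ).2.trans ht₂⟩
  -- On the ascending half this is the arc parameter; elsewhere it is still an admissible argument
  -- of `H`.
  have hrange : ∀ x, c - r + G.tent i c r x ∈ Icc 0 (G.len i) := fun x =>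
    ⟨by linarith [G.tent_nonneg i c r x], by linarith [G.tent_le i c hr0 x]⟩
  obtain ⟨q, hq, hq0⟩ := exists_denseRange_zero
  obtain ⟨Hc, hHc, hHceq⟩ := 𝓗.exists_continuous_extension i
  set gd : (ℝ → G.Point) → ℝ → ℝ := fun ξ => deriv fun t => G.tent i c r (ξ t).pos with hgd
  have hHm : ∀ {ξ : ℝ → G.Point}, AbsolutelyContinuousOnInterval ξ t₁ t₂ → ∀ {φ : ℝ → ℝ},
      Measurable φ → AEMeasurable (fun τ => Hc (c - r + G.tent i c r (ξ τ).pos, τ, φ τ))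
        (volume.restrict S) := fun hξ φ hφ =>
    hHc.measurable.comp_aemeasurable (((G.aemeasurable_tent hr hr' hξ hSI).const_add _).prodMk
      (aemeasurable_id.prodMk hφ.aemeasurable))
  have hΦ : ∀ j, AEMeasurable (fun τ => gd ζ τ * q j -
      Hc (c - r + G.tent i c r (ζ τ).pos, τ, q j)) (volume.restrict S) := fun j =>
    ((measurable_deriv _).aemeasurable.mul_const _).sub (hHm hζ measurable_const)
  -- The momentum is optimal along the limit curve, not along `ξ n`: weak convergence needs a test
  -- function independent of `n`.
  choose κ hκm hκk hκmax using fun k => exists_aemeasurable_argmax hΦ k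
  have hqm : ∀ k, Measurable fun τ => q (κ k τ) := fun k =>
    (measurable_from_nat (f := q)).comp (hκm k)
  -- The margin `ε` keeps `ξ n` on the ascending half, for large `n` and all times of `S` at once.
  have hξS : ∀ᶠ n in atTop, ∀ τ ∈ S, ∃ s ∈ Ioo (c - r) c, (ξ n τ).pos = G.arc i s := by
    filter_upwards [Metric.tendstoUniformlyOn_iff.1 hunif ε hε] with n hn τ hτ
    obtain ⟨s, hs, h⟩ := hSζ τ hτ
    obtain ⟨s', -, h2, h3⟩ := G.exists_arc_eq_of_dist_lt (i := i) (s := s) (ε := ε)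
      ⟨by linarith [hs.1], by linarith [hs.2]⟩ h (by linarith [hs.1]) (by linarith [hs.2])
      (by rw [dist_comm]; exact hn τ (hSI hτ))
    have := abs_lt.1 h3
    exact ⟨s', ⟨by linarith [hs.1], by linarith [hs.2]⟩, h2⟩
  have step : ∀ k, ∫⁻ τ in S, ENNReal.ofReal (q (κ k τ) * gd ζ τ +
      (K - Hc (c - r + G.tent i c r (ζ τ).pos, τ, q (κ k τ)))) ≤
      liminf (fun n => ∫⁻ τ in S, ENNReal.ofReal (F.integrand (ξ n) τ + K)) atTop := by
    intro k
    obtain ⟨C, hC⟩ := 𝓗.exists_abs_le hT (∑ j ∈ Finset.range (k + 1), |q j|)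
    have hbd := abs_comp_le_sum q (hκk k)
    refine lintegral_ofReal_le_liminf_of_minorant (C := |K| + C)
      (u := fun n τ => q (κ k τ) * gd (ξ n) τ)
      (b := fun n τ => K - Hc (c - r + G.tent i c r (ξ n τ).pos, τ, q (κ k τ)))
      (fun n => G.integrableOn_mul_deriv_tent hr hr' ht (hξ n) hSI (hqm k) hbd)
      (G.integrableOn_mul_deriv_tent hr hr' ht hζ hSI (hqm k) hbd)
      (G.tendsto_setIntegral_deriv_tent_mul hr hr' ht hξ hζ hunif hξM hζM hS hSI (hqm k) hbd)
      (fun n => ((hHm (hξ n) (hqm k)).const_sub K).aestronglyMeasurable) (fun n => ?_) ?_ ?_ ?_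
    · filter_upwards [ae_restrict_mem hS] with τ hτ
      rw [hHceq _ (hrange _) _ (hsub τ hτ).1]
      exact (abs_sub _ _).trans (add_le_add_right (hC i _ (hrange _) τ (hsub τ hτ) _ (hbd τ)) _)
    · filter_upwards [ae_restrict_mem hS] with τ hτ
      have h1 : Tendsto (fun n => G.tent i c r (ξ n τ).pos) atTop (𝓝 (G.tent i c r (ζ τ).pos)) :=
        ((G.lipschitzWith_tent hr hr').continuous.tendsto _).comp (hunif.tendsto_at (hSI hτ))
      exact ((hHc.tendsto _).comp ((h1.const_add _).prodMk_nhds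
        (tendsto_const_nhds.prodMk_nhds tendsto_const_nhds))).const_sub K
    -- Comparison with the momentum `q 0 = 0` shows that the limit minorant is nonnegative.
    · filter_upwards [ae_restrict_mem hS, hκmax k] with τ hτ hmax
      have h1 := hmax 0 (Nat.zero_le k)
      rw [hq0, mul_zero, hHceq _ (hrange _) τ (hsub τ hτ).1 0] at h1
      have h2 := hK i _ (hrange (ζ τ).pos) τ (hsub τ hτ)
      linarith
    · filter_upwards [hξS] with n hn
      filter_upwards [ae_restrict_mem hS, ae_restrict_of_ae_restrict_of_subset hSI
        (F.ae_integrand_eq hr hr' ht₁ (hξ n))] with τ hτ h1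
      rw [h1 (hn τ hτ), hHceq _ (hrange _) _ (hsub τ hτ).1]
      have h2 := 𝓗.le_arcLagrangian (hrange (ξ n τ).pos) (hsub τ hτ).1 (gd (ξ n) τ) (q (κ k τ))
      change _ ≤ 𝓗.arcLagrangian i (c - r + G.tent i c r (ξ n τ).pos) (gd (ξ n) τ) τ + K
      linarith
  -- The minorants along `ζ` tend to the integrand as `k → ∞`; Fatou's lemma in `k` finishes.
  refine le_trans (lintegral_mono_ae ?_) ((lintegral_liminf_le' fun k => ?_).trans
    ((liminf_le_liminf (Eventually.of_forall step)).trans_eq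
      (liminf_const (f := (atTop : Filter ℕ)) _)))
  · filter_upwards [ae_restrict_mem hS, ae_all_iff.2 hκmax, ae_restrict_of_ae_restrict_of_subset hSI
        (F.ae_integrand_eq hr hr' ht₁ hζ)] with τ hτ hmax h1
    obtain ⟨s, hs, h⟩ := hSζ τ hτ
    rw [h1 ⟨s, ⟨by linarith [hs.1], by linarith [hs.2]⟩, h⟩]
    refine le_of_eq (Tendsto.liminf_eq (ENNReal.tendsto_ofReal ?_)).symm
    simp only [hHceq _ (hrange _) τ (hsub τ hτ).1] at hmax ⊢
    have h2 := (𝓗.tendsto_arcLagrangian (hrange (ζ τ).pos) (hsub τ hτ).1 (gd ζ τ) hq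
      hmax).add_const K
    refine h2.congr fun k => ?_
    ring
  · exact (((hqm k).aemeasurable.mul (measurable_deriv _).aemeasurable).add
      ((hHm hζ (hqm k)).const_sub K)).ennreal_ofReal

/-- Lower semicontinuity on a set of times at which the limit curve is at a vertex. -/
theorem lintegral_le_liminf_of_vertex (F : FluxLimiter 𝓗) {t₁ t₂ T K : ℝ} (ht₁ : 0 ≤ t₁)
    (ht : t₁ ≤ t₂) (hT : 0 < T) (ht₂ : t₂ ≤ T)
    (hcK : ∀ x ∈ G.vertices, ∀ t ∈ Icc 0 T, |F.c x t| ≤ K)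
    (hK : ∀ i, ∀ s ∈ Icc 0 (G.len i), ∀ t ∈ Icc 0 T, 𝓗.H i s t 0 ≤ K)
    {ξ : ℕ → ℝ → G.Point} {ζ : ℝ → G.Point}
    (hξ : ∀ n, AbsolutelyContinuousOnInterval (ξ n) t₁ t₂)
    (hζ : AbsolutelyContinuousOnInterval ζ t₁ t₂)
    (hunif : TendstoUniformlyOn ξ ζ atTop (Icc t₁ t₂)) {M : NNReal}
    (hξM : ∀ n, eLpNorm (deriv fun t => (ξ n t).pos) 2 (volume.restrict (Icc t₁ t₂)) ≤ M)
    (hζM : eLpNorm (deriv fun t => (ζ t).pos) 2 (volume.restrict (Icc t₁ t₂)) ≤ M)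
    {S : Set ℝ} (hS : MeasurableSet S) (hSI : S ⊆ Icc t₁ t₂) {x : EuclideanSpace ℝ (Fin N)}
    (hx : x ∈ G.vertices) (hSζ : ∀ τ ∈ S, (ζ τ).pos = x) :
    ∫⁻ τ in S, ENNReal.ofReal (F.integrand ζ τ + K) ≤
      liminf (fun n => ∫⁻ τ in S, ENNReal.ofReal (F.integrand (ξ n) τ + K)) atTop := by
  have : IsFiniteMeasure (volume.restrict S) := ⟨by
    rw [Measure.restrict_apply_univ]
    exact (measure_mono hSI).trans_lt measure_Icc_lt_top⟩
  have hsub : ∀ τ ∈ S, τ ∈ Icc 0 T := fun τ hτ =>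
    ⟨ht₁.trans (hSI hτ).1, (hSI hτ).2.trans ht₂⟩
  -- The tents centred at `δ` with radius `δ` live on parameters in `[0, 2δ]`. A quarter of the
  -- minimal length keeps apart the two tents of a loop, one for each orientation.
  obtain ⟨δ, hδ0, hδ⟩ : ∃ d : ℝ, 0 < d ∧ ∀ i, 4 * d ≤ G.len i := by
    obtain ⟨δ, h1, h2⟩ := G.exists_le_len
    exact ⟨δ / 4, by positivity, fun i => by linarith [h2 i]⟩
  have hδ2 : ∀ i, δ + δ ≤ G.len i := fun i => by linarith [hδ i]
  have hrange : ∀ i x, G.tent i δ δ x ∈ Icc 0 (G.len i) := fun i x =>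
    ⟨G.tent_nonneg i δ δ x, by linarith [G.tent_le i δ hδ0.le x, hδ2 i]⟩
  obtain ⟨E, hEmem⟩ : ∃ E : Finset ι, ∀ i, i ∈ E ↔ G.arc i 0 = x :=
    ⟨(G.finite_arcs_from x).toFinset, fun i => by simp⟩
  have hE : E.Nonempty := by
    obtain ⟨i, s, hs, h1, h2, h3⟩ := Network.Route.exists_arc_eq_of_vertex (δ := δ)
      (fun i => by linarith [hδ i]) (Network.Route.refl (G := G) x) hx hδ0
    exact ⟨i, (hEmem i).2 h1⟩
  obtain ⟨q, hq, hq0⟩ := exists_denseRange_zero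
  choose Hc hHc hHceq using 𝓗.exists_continuous_extension
  set gd : ι → (ℝ → G.Point) → ℝ → ℝ := fun i ξ => deriv fun t => G.tent i δ δ (ξ t).pos with hgd
  obtain ⟨cc, hcc, hcceq⟩ : ∃ cc : ℝ → ℝ, Continuous cc ∧ ∀ τ, 0 ≤ τ → cc τ = F.c x τ :=
    ⟨fun τ => F.c x (max τ 0), (F.continuousOn x hx).comp_continuous (by fun_prop)
      (fun τ => mem_Ici.2 (le_max_right _ _)), fun τ hτ => by simp only [max_eq_left hτ]⟩
  have hΦ : ∀ i j, Measurable fun τ => -Hc i (0, τ, q j) := fun i j =>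
    ((hHc i).comp (by fun_prop)).neg.measurable
  -- One momentum per outgoing arc, optimal at the vertex with zero velocity.
  choose κ hκm hκk hκmax using fun i k => exists_measurable_argmax (hΦ i) k
  have hqm : ∀ i k, Measurable fun τ => q (κ i k τ) := fun i k =>
    (measurable_from_nat (f := q)).comp (hκm i k)
  have hHm : ∀ {ξ : ℝ → G.Point}, AbsolutelyContinuousOnInterval ξ t₁ t₂ → ∀ k,
      AEMeasurable (fun τ => E.inf' hE fun i =>
        min (cc τ) (-Hc i (G.tent i δ δ (ξ τ).pos, τ, q (κ i k τ))))
        (volume.restrict S) := fun hξ k =>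
    Finset.aemeasurable_inf'_apply hE fun i _ => hcc.aemeasurable.min
      ((hHc i).measurable.comp_aemeasurable ((G.aemeasurable_tent le_rfl (hδ2 i) hξ hSI).prodMk
        (aemeasurable_id.prodMk (hqm i k).aemeasurable))).neg
  have htent : ∀ i, ∀ τ ∈ S, G.tent i δ δ (ζ τ).pos = 0 := fun i τ hτ =>
    G.tent_of_mem_vertices i δ δ (by rw [hSζ τ hτ]; exact hx)
  have hgd0 : ∀ i, ∀ τ ∈ S, gd i ζ τ = 0 := fun i τ hτ => G.deriv_tent_eq_zero (htent i τ hτ)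
  have hmin : ∀ k, ∀ τ ∈ S, -K ≤ E.inf' hE fun i =>
        min (cc τ) (-Hc i (G.tent i δ δ (ζ τ).pos, τ, q (κ i k τ))) := by
    intro k τ hτ
    refine Finset.le_inf' _ _ fun i _ => le_min ?_ ?_
    · rw [hcceq τ (hsub τ hτ).1]
      exact (abs_le.1 (hcK x hx τ (hsub τ hτ))).1
    · have h1 := hκmax i k τ 0 (Nat.zero_le k)
      rw [hq0, hHceq i 0 (G.zero_mem_Icc_len i) τ (hsub τ hτ).1 0] at h1
      rw [htent i τ hτ]
      linarith [hK i 0 (G.zero_mem_Icc_len i) τ (hsub τ hτ)]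
  -- The infimum is at most `c_x`, used when `ξ n` is at `x`, and at most each `-H_i`, used when `ξ
  -- n` is inside arc `i`. The sum contributes nothing in the first case and only the term of arc
  -- `i` in the second.
  have hlow : ∀ᶠ n in atTop, ∀ k, ∀ᵐ τ ∂volume.restrict S,
      ∑ i ∈ E, q (κ i k τ) * gd i (ξ n) τ + ((E.inf' hE fun i =>
        min (cc τ) (-Hc i (G.tent i δ δ (ξ n τ).pos, τ, q (κ i k τ)))) + K) ≤
      F.integrand (ξ n) τ + K := by
    filter_upwards [Metric.tendstoUniformlyOn_iff.1 hunif δ hδ0] with n hn k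
    have hae : ∀ᵐ τ ∂volume.restrict S, ∀ i ∈ E, (∃ s ∈ Ioo (δ - δ) δ, (ξ n τ).pos = G.arc i s) →
        F.integrand (ξ n) τ =
          𝓗.arcLagrangian i (δ - δ + G.tent i δ δ (ξ n τ).pos) (gd i (ξ n) τ) τ :=
      (Finset.eventually_all E).2 fun i _ => ae_restrict_of_ae_restrict_of_subset hSI
        (F.ae_integrand_eq le_rfl (hδ2 i) ht₁ (hξ n))
    filter_upwards [ae_restrict_mem hS, hae] with τ hτ hae
    have hd : dist (ξ n τ) (ζ τ) < δ := by
      rw [dist_comm]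
      exact hn τ (hSI hτ)
    obtain ⟨i, s, hs, h1, h2, h3⟩ := G.exists_arc_eq_of_dist_vertex_lt (δ := δ)
      (fun i => by linarith [hδ i]) le_rfl (by rw [hSζ τ hτ]; exact hx) hd
    rw [hSζ τ hτ] at h1
    have hiE := (hEmem i).2 h1
    have hle := Finset.inf'_le (s := E) (fun i =>
        min (cc τ) (-Hc i (G.tent i δ δ (ξ n τ).pos, τ, q (κ i k τ)))) hiE
    rcases hs.1.eq_or_lt with h0 | h0
    · have hv : (ξ n τ).pos = x := by rw [h2, ← h0, h1]
      have hsum : ∑ i ∈ E, q (κ i k τ) * gd i (ξ n) τ = 0 := Finset.sum_eq_zero fun j _ => by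
        have : gd j (ξ n) τ = 0 :=
          G.deriv_tent_eq_zero (G.tent_of_mem_vertices j δ δ (by rw [hv]; exact hx))
        rw [this, mul_zero]
      have hint : F.c x τ ≤ F.integrand (ξ n) τ := by
        rw [integrand, F.lagrangian_of_mem_vertices _ _ _ (by rw [hv]; exact hx), hv]
        linarith [sq_nonneg ‖deriv (fun r => (ξ n r).pos) τ‖]
      have h4 := hle.trans (min_le_left _ _)
      have h5 := hcceq τ (hsub τ hτ).1
      linarith
    · have hsm : s ∈ Ioo 0 (G.len i) := ⟨h0, by linarith [hδ i]⟩
      have hsum : ∑ i ∈ E, q (κ i k τ) * gd i (ξ n) τ = q (κ i k τ) * gd i (ξ n) τ := by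
        refine Finset.sum_eq_single i (fun j _ hji => ?_) fun h => absurd hiE h
        have : G.tent j δ δ (ξ n τ).pos = 0 := by
          rw [h2]
          -- For the reversed arc, as happens on a loop, the parameter is `len i - s > 3δ`, beyond
          -- the support of its tent.
          by_cases hrev : j = G.rev i
          · have h4 : G.arc i s = G.arc j (G.len i - s) := by
              rw [hrev, G.arc_rev i _ ⟨by linarith [hsm.2], by linarith⟩, sub_sub_cancel]
            have h5 : G.len i - s ∈ Icc 0 (G.len j) := by
              rw [hrev, G.len_rev]
              exact ⟨by linarith [hsm.2], by linarith⟩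
            rw [h4, G.tent_arc le_rfl (hδ2 j) h5, abs_of_nonneg (by linarith [hδ i])]
            exact max_eq_left (by linarith [hδ i])
          · refine G.tent_eq_zero fun s' hs' h4 => ?_
            exact Set.disjoint_left.1 (G.no_overlap i j hji hrev) ⟨s, hsm, rfl⟩
              ⟨s', Ioo_subset_Icc_self hs', h4.symm⟩
        have : gd j (ξ n) τ = 0 := G.deriv_tent_eq_zero this
        rw [this, mul_zero]
      rw [hsum, hae i hiE ⟨s, ⟨by linarith, h3⟩, h2⟩, sub_self, zero_add]
      have h4 := hle.trans (min_le_right _ _)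
      rw [hHceq i _ (hrange i _) τ (hsub τ hτ).1] at h4
      have h5 := 𝓗.le_arcLagrangian (hrange i (ξ n τ).pos) (hsub τ hτ).1 (gd i (ξ n) τ)
        (q (κ i k τ))
      linarith
  have step : ∀ k, ∫⁻ τ in S, ENNReal.ofReal (∑ i ∈ E, q (κ i k τ) * gd i ζ τ +
      ((E.inf' hE fun i => min (cc τ) (-Hc i (G.tent i δ δ (ζ τ).pos, τ, q (κ i k τ)))) + K)) ≤
      liminf (fun n => ∫⁻ τ in S, ENNReal.ofReal (F.integrand (ξ n) τ + K)) atTop := by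
    intro k
    obtain ⟨C, hC⟩ := 𝓗.exists_abs_le hT (∑ j ∈ Finset.range (k + 1), |q j|)
    have hbd := fun i => abs_comp_le_sum q (hκk i k)
    have hint : ∀ {ξ : ℝ → G.Point}, AbsolutelyContinuousOnInterval ξ t₁ t₂ → ∀ i ∈ E,
        IntegrableOn (fun τ => q (κ i k τ) * gd i ξ τ) S := fun hξ i _ =>
      G.integrableOn_mul_deriv_tent le_rfl (hδ2 i) ht hξ hSI (hqm i k) (hbd i)
    refine lintegral_ofReal_le_liminf_of_minorant (C := max K C + |K|)
      (u := fun n τ => ∑ i ∈ E, q (κ i k τ) * gd i (ξ n) τ)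
      (b := fun n τ => (E.inf' hE fun i =>
        min (cc τ) (-Hc i (G.tent i δ δ (ξ n τ).pos, τ, q (κ i k τ)))) + K)
      (fun n => integrable_finsetSum _ (hint (hξ n))) (integrable_finsetSum _ (hint hζ)) ?_
      (fun n => ((hHm (hξ n) k).add_const K).aestronglyMeasurable) (fun n => ?_) ?_ ?_
      (hlow.mono fun n hn => hn k)
    · rw [integral_finsetSum _ (hint hζ)]
      simp only [fun n => integral_finsetSum _ (hint (hξ n))]
      exact tendsto_finsetSum _ fun i _ => G.tendsto_setIntegral_deriv_tent_mul le_rfl (hδ2 i) ht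
        hξ hζ hunif hξM hζM hS hSI (hqm i k) (hbd i)
    · filter_upwards [ae_restrict_mem hS] with τ hτ
      refine (abs_add_le _ _).trans (add_le_add_left ?_ _)
      obtain ⟨i, hi, h⟩ := Finset.exists_mem_eq_inf' hE fun i =>
        min (cc τ) (-Hc i (G.tent i δ δ (ξ n τ).pos, τ, q (κ i k τ)))
      rw [h]
      refine abs_min_le_max_abs_abs.trans (max_le_max ?_ ?_)
      · rw [hcceq τ (hsub τ hτ).1]
        exact hcK x hx τ (hsub τ hτ)
      · rw [abs_neg, hHceq i _ (hrange i _) τ (hsub τ hτ).1]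
        exact hC i _ (hrange i _) τ (hsub τ hτ) _ (hbd i τ)
    · filter_upwards [ae_restrict_mem hS] with τ hτ
      refine (Tendsto.finset_inf'_nhds_apply hE fun i _ => ?_).add_const K
      have h1 : Tendsto (fun n => G.tent i δ δ (ξ n τ).pos) atTop (𝓝 (G.tent i δ δ (ζ τ).pos)) :=
        ((G.lipschitzWith_tent le_rfl (hδ2 i)).continuous.tendsto _).comp
          (hunif.tendsto_at (hSI hτ))
      exact tendsto_const_nhds.min (((hHc i).tendsto _).comp (h1.prodMk_nhds
        (tendsto_const_nhds.prodMk_nhds tendsto_const_nhds))).neg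
    · filter_upwards [ae_restrict_mem hS] with τ hτ
      rw [Finset.sum_eq_zero fun i _ => by rw [hgd0 i τ hτ, mul_zero]]
      linarith [hmin k τ hτ]
  refine le_trans (lintegral_mono_ae ?_) ((lintegral_liminf_le' fun k => ?_).trans
    ((liminf_le_liminf (Eventually.of_forall step)).trans_eq
      (liminf_const (f := (atTop : Filter ℕ)) _)))
  -- Since `ζ` is constant on `S`, its velocity vanishes almost everywhere there and only the flux
  -- limiter remains.
  · filter_upwards [ae_restrict_mem hS, ae_restrict_of_ae
      (ae_deriv_eq_zero_of_eq (fun t => (ζ t).pos) x)] with τ hτ h1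
    have h2 : F.integrand ζ τ = cc τ := by
      rw [integrand, F.lagrangian_of_mem_vertices _ _ _ (by rw [hSζ τ hτ]; exact hx),
        h1 (hSζ τ hτ), hSζ τ hτ, hcceq τ (hsub τ hτ).1]
      simp
    rw [h2]
    refine le_of_eq (Tendsto.liminf_eq (ENNReal.tendsto_ofReal ?_)).symm
    simp only [hgd0 _ τ hτ, mul_zero, Finset.sum_const_zero, zero_add, htent _ τ hτ]
    refine Tendsto.add_const K ?_
    -- The upper bound on the flux limiter enters here: the minimum loses nothing in the limit `k →
    -- ∞`.
    have h3 : cc τ = E.inf' hE fun i => min (cc τ) (𝓗.arcLagrangian i 0 0 τ) := by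
      refine (Finset.inf'_eq_of_forall hE _ fun i hi => min_eq_left ?_).symm
      rw [hcceq τ (hsub τ hτ).1]
      exact F.le_arcLagrangian x hx τ (hsub τ hτ).1 i ((hEmem i).1 hi)
    conv => rhs; rw [h3]
    refine Tendsto.finset_inf'_nhds_apply hE fun i _ => tendsto_const_nhds.min ?_
    have h4 := 𝓗.tendsto_arcLagrangian (G.zero_mem_Icc_len i) (hsub τ hτ).1 0 hq
      (κ := fun k => κ i k τ) (fun k j hj => by
        have := hκmax i k τ j hj
        rw [hHceq i 0 (G.zero_mem_Icc_len i) τ (hsub τ hτ).1,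
          hHceq i 0 (G.zero_mem_Icc_len i) τ (hsub τ hτ).1] at this
        simpa using this)
    refine h4.congr fun k => ?_
    rw [hHceq i 0 (G.zero_mem_Icc_len i) τ (hsub τ hτ).1, zero_mul, zero_sub]
  · exact ((Finset.aemeasurable_fun_sum _ fun i _ => (hqm i k).aemeasurable.mul
      (measurable_deriv _).aemeasurable).add ((hHm hζ k).add_const K)).ennreal_ofReal

end FluxLimiter

/-! ### Extended-real arithmetic -/

theorem EReal.coe_ennreal_sub_eq_of_add_eq {P Q A B : ENNReal} (hA : A ≠ ⊤) (hB : B ≠ ⊤)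
    (h : P + B = Q + A) : (P : EReal) - A = Q - B := by
  lift A to NNReal using hA
  lift B to NNReal using hB
  induction P using ENNReal.recTopCoe with
  | top =>
    have : Q = ⊤ := by
      by_contra hQ
      rw [top_add] at h
      exact ENNReal.add_ne_top.2 ⟨hQ, ENNReal.coe_ne_top⟩ h.symm
    rw [this]
    rfl
  | coe P =>
    have hQ : Q ≠ ⊤ := by
      rintro rfl
      rw [top_add] at h
      exact ENNReal.add_ne_top.2 ⟨ENNReal.coe_ne_top, ENNReal.coe_ne_top⟩ h
    lift Q to NNReal using hQ
    have h' : (P : ℝ) + B = Q + A := by exact_mod_cast h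
    change ((P : ℝ) : EReal) - ((A : ℝ) : EReal) = ((Q : ℝ) : EReal) - ((B : ℝ) : EReal)
    rw [← EReal.coe_sub, ← EReal.coe_sub]
    congr 1
    linarith

theorem EReal.coe_ennreal_sub_le_liminf {Q : ENNReal} {q : ℕ → ENNReal} {B : ENNReal} (hB : B ≠ ⊤)
    (h : Q ≤ liminf q atTop) :
    (Q : EReal) - B ≤ liminf (fun n => (q n : EReal) - B) atTop := by
  have hmono : Monotone fun y : ENNReal => (y : EReal) - B := fun y z hyz =>
    EReal.sub_le_sub (EReal.coe_ennreal_le_coe_ennreal_iff.2 hyz) le_rfl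
  have hcont : Continuous fun y : ENNReal => (y : EReal) - B := by
    lift B to NNReal using hB
    refine continuous_iff_continuousAt.2 fun y => ?_
    have h1 : ContinuousAt (fun p : EReal × EReal => p.1 + p.2) ((y : EReal), -((B : ℝ) : EReal)) :=
      EReal.continuousAt_add (Or.inr (by rw [← EReal.coe_neg]; exact EReal.coe_ne_bot _))
        (Or.inr (by rw [← EReal.coe_neg]; exact EReal.coe_ne_top _))
    exact ContinuousAt.comp (f := fun y : ENNReal => ((y : EReal), -((B : ℝ) : EReal))) h1
      (continuous_coe_ennreal_ereal.prodMk continuous_const).continuousAt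
  exact (hmono h).trans_eq (hmono.map_liminf_of_continuousAt q hcont.continuousAt)

/-! ### The countable cover of the time interval -/

namespace Network

variable {N : ℕ} {ι : Type*}

theorem countable_vertices [Countable ι] (G : Network N ι) : G.vertices.Countable := by
  refine ((countable_range fun i => G.arc i 0).union
    (countable_range fun i => G.arc i (G.len i))).mono ?_
  rintro x ⟨i, rfl | rfl⟩
  · exact Or.inl ⟨i, rfl⟩
  · exact Or.inr ⟨i, rfl⟩

/-- The times at which a curve is at a given vertex, or in a given part of the interior of an
arc. -/
def timesIn (G : Network N ι) (t₁ t₂ : ℝ) (ξ : ℝ → G.Point) : G.vertices ⊕ ι × ℚ × ℕ → Set ℝ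
  | Sum.inl x => {τ ∈ Icc t₁ t₂ | (ξ τ).pos = x}
  | Sum.inr (i, c, m) => {τ ∈ Icc t₁ t₂ | ∃ s ∈ Ioo (c - min (c : ℝ) (G.len i - c) + 1 / (m + 1))
      (c - 1 / (m + 1)), (ξ τ).pos = G.arc i s}

theorem measurableSet_timesIn (G : Network N ι) {t₁ t₂ : ℝ} {ξ : ℝ → G.Point}
    (hξ : ContinuousOn ξ (Icc t₁ t₂)) (k : G.vertices ⊕ ι × ℚ × ℕ) :
    MeasurableSet (G.timesIn t₁ t₂ ξ k) := by
  rcases k with x | ⟨i, c, m⟩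
  · have hpos : ContinuousOn (fun τ => (ξ τ).pos) (Icc t₁ t₂) := by
      have : LipschitzWith 1 fun p : G.Point => p.pos := LipschitzWith.of_dist_le_mul fun p p' => by
        rw [NNReal.coe_one, one_mul]
        exact le_csInf (G.exists_route p p') fun l hl => Route.dist_le hl
      exact this.continuous.comp_continuousOn hξ
    exact (hpos.preimage_isClosed_of_isClosed isClosed_Icc isClosed_singleton).measurableSet
  · have hm : (0 : ℝ) < 1 / (m + 1) := Nat.one_div_pos_of_nat
    have h1 := min_le_left (c : ℝ) (G.len i - c)
    have h2 := min_le_right (c : ℝ) (G.len i - c)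
    by_cases hc : (c : ℝ) - 1 / (m + 1) ≤ G.len i
    · obtain ⟨u, hu, h⟩ := continuousOn_iff'.1 hξ _ (G.isOpen_arc_Ioo (i := i)
        (a := c - min (c : ℝ) (G.len i - c) + 1 / (m + 1)) (by linarith) hc)
      have : G.timesIn t₁ t₂ ξ (Sum.inr (i, c, m)) = u ∩ Icc t₁ t₂ := by
        rw [← h, inter_comm]
        rfl
      rw [this]
      exact hu.measurableSet.inter measurableSet_Icc
    -- Here `c` exceeds the length, so the radius is negative and the parameter interval is empty.
    · have : G.timesIn t₁ t₂ ξ (Sum.inr (i, c, m)) = ∅ := by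
        refine eq_empty_of_forall_notMem ?_
        rintro τ ⟨-, s, hs, -⟩
        have := hs.1.trans hs.2
        linarith
      rw [this]
      exact MeasurableSet.empty

theorem Icc_subset_iUnion_timesIn (G : Network N ι) {t₁ t₂ : ℝ} (ξ : ℝ → G.Point) :
    Icc t₁ t₂ ⊆ ⋃ k, G.timesIn t₁ t₂ ξ k := by
  intro τ hτ
  by_cases hv : (ξ τ).pos ∈ G.vertices
  · exact mem_iUnion.2 ⟨Sum.inl ⟨_, hv⟩, hτ, rfl⟩
  · obtain ⟨⟨i, s⟩, hs, h⟩ := G.exists_interior_of_not_mem_vertices _ hv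
    dsimp only at hs h
    -- With the largest admissible radius `min c (len - c)`, the ascending half begins at `0` or at
    -- `2c - len`; both are below `s` because `c < (s + len) / 2`.
    obtain ⟨c, hc1, hc2⟩ := exists_rat_btwn (show s < (s + G.len i) / 2 by linarith [hs.2])
    have h1 : c - min (c : ℝ) (G.len i - c) < s := by
      rcases min_choice (c : ℝ) (G.len i - c) with h | h <;> rw [h] <;> linarith [hs.1]
    obtain ⟨m, hm⟩ := exists_nat_one_div_lt
      (lt_min (sub_pos.2 h1) (sub_pos.2 hc1))
    have h2 := lt_min_iff.1 hm
    exact mem_iUnion.2 ⟨Sum.inr (i, c, m), hτ, s, ⟨by linarith [h2.1], by linarith [h2.2]⟩, h.symm⟩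

end Network

/-! ### Measurability of the integrand and the action -/

namespace FluxLimiter

variable {N : ℕ} {ι : Type*} {G : Network N ι} {𝓗 : NetworkHamiltonian G}

/-- Measurability is checked on each member of the countable cover: at a vertex the integrand is
explicit, and on an arc it is a countable supremum of measurable functions in tent coordinates. -/
theorem aemeasurable_integrand [Countable ι] (F : FluxLimiter 𝓗) {t₁ t₂ : ℝ} (ht₁ : 0 ≤ t₁)
    {ξ : ℝ → G.Point} (hξ : AbsolutelyContinuousOnInterval ξ t₁ t₂) :
    AEMeasurable (F.integrand ξ) (volume.restrict (Icc t₁ t₂)) := by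
  have := G.countable_vertices.to_subtype
  refine AEMeasurable.mono_measure ?_
    (Measure.restrict_mono (G.Icc_subset_iUnion_timesIn (t₁ := t₁) (t₂ := t₂) ξ) le_rfl)
  refine aemeasurable_iUnion_iff.2 fun k => ?_
  have hk := G.measurableSet_timesIn hξ.continuousOn_Icc k
  rcases k with ⟨x, hx⟩ | ⟨i, c, m⟩
  · have hcc : Continuous fun τ => F.c x (max τ 0) := (F.continuousOn x hx).comp_continuous
      (by fun_prop) (fun τ => mem_Ici.2 (le_max_right _ _))
    have hm : Measurable fun τ => ‖deriv (fun r => (ξ r).pos) τ‖ ^ 2 / 2 + F.c x (max τ 0) :=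
      (((measurable_deriv _).norm.pow_const 2).div_const 2).add hcc.measurable
    refine hm.aemeasurable.congr ?_
    filter_upwards [ae_restrict_mem hk] with τ hτ
    have h2 : (ξ τ).pos = x := hτ.2
    rw [integrand, F.lagrangian_of_mem_vertices _ _ _ (by rwa [h2]), h2,
      max_eq_left (ht₁.trans hτ.1.1)]
  · have hr := min_le_left (c : ℝ) (G.len i - c)
    have hr' : (c : ℝ) + min (c : ℝ) (G.len i - c) ≤ G.len i := by
      linarith [min_le_right (c : ℝ) (G.len i - c)]
    have hmp : (0 : ℝ) < 1 / (m + 1) := Nat.one_div_pos_of_nat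
    have hsub : G.timesIn t₁ t₂ ξ (Sum.inr (i, c, m)) ⊆ Icc t₁ t₂ := fun τ hτ => hτ.1
    obtain ⟨q, hq, -⟩ := exists_denseRange_zero
    obtain ⟨Hc, hHc, hHceq⟩ := 𝓗.exists_continuous_extension i
    have hg := G.aemeasurable_tent hr hr' hξ hsub
    have hm : AEMeasurable (fun τ => ⨆ j, (deriv (fun t =>
        G.tent i c (min (c : ℝ) (G.len i - c)) (ξ t).pos) τ * q j -
        Hc (c - min (c : ℝ) (G.len i - c) +
          G.tent i c (min (c : ℝ) (G.len i - c)) (ξ τ).pos, τ, q j)))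
        (volume.restrict (G.timesIn t₁ t₂ ξ (Sum.inr (i, c, m)))) :=
      AEMeasurable.iSup fun j => ((measurable_deriv _).aemeasurable.mul_const _).sub
        (hHc.measurable.comp_aemeasurable ((hg.const_add _).prodMk
          (aemeasurable_id.prodMk aemeasurable_const)))
    refine hm.congr ?_
    filter_upwards [ae_restrict_mem hk, ae_restrict_of_ae_restrict_of_subset hsub
      (F.ae_integrand_eq hr hr' ht₁ hξ)] with τ hτ h1
    obtain ⟨h2, s, hs, h3⟩ := hτ
    have h4 : (0 : ℝ) ≤ min (c : ℝ) (G.len i - c) := by linarith [hs.1, hs.2]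
    have h5 : c - min (c : ℝ) (G.len i - c) +
        G.tent i c (min (c : ℝ) (G.len i - c)) (ξ τ).pos ∈ Icc 0 (G.len i) :=
      ⟨by linarith [G.tent_nonneg i c (min (c : ℝ) (G.len i - c)) (ξ τ).pos],
        by linarith [G.tent_le i c h4 (ξ τ).pos]⟩
    rw [h1 ⟨s, ⟨by linarith [hs.1], by linarith [hs.2]⟩, h3⟩,
      𝓗.arcLagrangian_eq_iSup_dense h5 (ht₁.trans h2.1) _ hq]
    exact iSup_congr fun j => by rw [hHceq _ h5 τ (ht₁.trans h2.1)]

/-- If the integrand is bounded from below, the action is well defined and is the integral of a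
nonnegative function up to a constant. -/
theorem actionWellDefined_and_action_eq (F : FluxLimiter 𝓗) {t₁ t₂ K : ℝ} {ξ : ℝ → G.Point}
    (hm : AEMeasurable (F.integrand ξ) (volume.restrict (Icc t₁ t₂))) (hK0 : 0 ≤ K)
    (hK : ∀ τ ∈ Icc t₁ t₂, -K ≤ F.integrand ξ τ) :
    F.ActionWellDefined t₁ t₂ ξ ∧ F.action t₁ t₂ ξ =
      ((∫⁻ τ in Icc t₁ t₂, ENNReal.ofReal (F.integrand ξ τ + K) : ENNReal) : EReal) -
        ((∫⁻ _ in Icc t₁ t₂, ENNReal.ofReal K : ENNReal) : EReal) := by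
  have hfin : ∫⁻ _ in Icc t₁ t₂, ENNReal.ofReal K < ⊤ := by
    rw [setLIntegral_const]
    exact ENNReal.mul_lt_top ENNReal.ofReal_lt_top measure_Icc_lt_top
  have hneg : ∫⁻ τ in Icc t₁ t₂, ENNReal.ofReal (-F.integrand ξ τ) < ⊤ := by
    refine (setLIntegral_mono' measurableSet_Icc fun τ hτ => ?_).trans_lt hfin
    exact ENNReal.ofReal_le_ofReal (by linarith [hK τ hτ])
  refine ⟨⟨hm, hneg⟩, EReal.coe_ennreal_sub_eq_of_add_eq hneg.ne hfin.ne ?_⟩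
  have hmneg : AEMeasurable (fun τ => ENNReal.ofReal (-F.integrand ξ τ))
      (volume.restrict (Icc t₁ t₂)) := hm.neg.ennreal_ofReal
  rw [← lintegral_add_right _ measurable_const, ← lintegral_add_right' _ hmneg]
  refine setLIntegral_congr_fun measurableSet_Icc fun τ hτ => ?_
  rcases le_total 0 (F.integrand ξ τ) with h | h
  · rw [ENNReal.ofReal_of_nonpos (neg_nonpos.2 h), add_zero, ENNReal.ofReal_add h hK0]
  · rw [ENNReal.ofReal_of_nonpos h, zero_add,
      ← ENNReal.ofReal_add (by linarith [hK τ hτ]) (neg_nonneg.2 h)]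
    congr 1
    ring

end FluxLimiter

/-! ### Conclusion -/

theorem mainTheorem4 {N : ℕ} {ι : Type*} [Countable ι] (G : Network N ι)
    (𝓗 : NetworkHamiltonian G) (F : FluxLimiter 𝓗)
    (t₁ t₂ : ℝ) (ht₁ : 0 ≤ t₁) (ht : t₁ ≤ t₂)
    (ξ : ℕ → ℝ → G.Point) (ζ : ℝ → G.Point)
    (hξ : ∀ n, AbsolutelyContinuousOnInterval (ξ n) t₁ t₂)
    (hζ : AbsolutelyContinuousOnInterval ζ t₁ t₂)
    (hunif : TendstoUniformlyOn ξ ζ atTop (Icc t₁ t₂))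
    (hξ2 : ∀ n, MemLp (deriv fun r => (ξ n r).pos) 2 (volume.restrict (Icc t₁ t₂)))
    (hζ2 : MemLp (deriv fun r => (ζ r).pos) 2 (volume.restrict (Icc t₁ t₂)))
    (hweak : ∀ φ : ℝ → EuclideanSpace ℝ (Fin N), MemLp φ 2 (volume.restrict (Icc t₁ t₂)) →
      Tendsto (fun n => ∫ τ in Icc t₁ t₂, inner ℝ (φ τ) (deriv (fun r => (ξ n r).pos) τ)) atTop
        (𝓝 (∫ τ in Icc t₁ t₂, inner ℝ (φ τ) (deriv (fun r => (ζ r).pos) τ)))) :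
    (∀ n, F.ActionWellDefined t₁ t₂ (ξ n)) ∧ F.ActionWellDefined t₁ t₂ ζ ∧
      F.action t₁ t₂ ζ ≤ liminf (fun n => F.action t₁ t₂ (ξ n)) atTop := by
  have hT : 0 < t₂ + 1 := by linarith
  have ht₂ : t₂ ≤ t₂ + 1 := by linarith
  obtain ⟨K, hK0, hcK, hHK, hLK⟩ := F.exists_lower_bound hT
  have hbound : ∀ ξ : ℝ → G.Point, ∀ τ ∈ Icc t₁ t₂, -K ≤ F.integrand ξ τ := fun ξ τ hτ =>
    hLK _ _ τ ⟨ht₁.trans hτ.1, hτ.2.trans ht₂⟩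
  have hact := fun n => F.actionWellDefined_and_action_eq (F.aemeasurable_integrand ht₁ (hξ n)) hK0
    (hbound (ξ n))
  have hactζ := F.actionWellDefined_and_action_eq (F.aemeasurable_integrand ht₁ hζ) hK0 (hbound ζ)
  refine ⟨fun n => (hact n).1, hactζ.1, ?_⟩
  -- Weak convergence enters only through this uniform bound; the weak limits of the tent
  -- derivatives are identified by uniform convergence.
  obtain ⟨M, hM⟩ : ∃ M : NNReal, (∀ n, eLpNorm (deriv fun r => (ξ n r).pos) 2
      (volume.restrict (Icc t₁ t₂)) ≤ M) ∧
      eLpNorm (deriv fun r => (ζ r).pos) 2 (volume.restrict (Icc t₁ t₂)) ≤ M := by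
    obtain ⟨M, hM⟩ := exists_eLpNorm_le_of_tendsto_integral_inner hξ2
      (l := fun φ => ∫ τ in Icc t₁ t₂, inner ℝ (φ τ) (deriv (fun r => (ζ r).pos) τ)) hweak
    refine ⟨max M (eLpNorm (deriv fun r => (ζ r).pos) 2 (volume.restrict (Icc t₁ t₂))).toNNReal,
      fun n => (hM n).trans (ENNReal.coe_le_coe.2 (le_max_left _ _)), ?_⟩
    exact (ENNReal.coe_toNNReal hζ2.2.ne).symm.le.trans (ENNReal.coe_le_coe.2 (le_max_right _ _))
  rw [hactζ.2]
  simp only [fun n => (hact n).2]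
  have := G.countable_vertices.to_subtype
  -- All actions are integrals of nonnegative functions minus the same finite constant, so the
  -- inequality reduces to the nonnegative integrals, on the cover adapted to `ζ`.
  refine EReal.coe_ennreal_sub_le_liminf ?_ (lintegral_le_liminf_of_cover
    (G.measurableSet_timesIn hζ.continuousOn_Icc) measurableSet_Icc
    (G.Icc_subset_iUnion_timesIn ζ) ?_)
  · rw [setLIntegral_const]
    exact (ENNReal.mul_lt_top ENNReal.ofReal_lt_top measure_Icc_lt_top).ne
  · rintro (⟨x, hx⟩ | ⟨i, c, m⟩) S hSk hSI hS
    · exact F.lintegral_le_liminf_of_vertex ht₁ ht hT ht₂ hcK hHK hξ hζ hunif hM.1 hM.2 hS hSI hx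
        fun τ hτ => (hSk hτ).2
    · exact F.lintegral_le_liminf_of_arc (min_le_left (c : ℝ) (G.len i - c))
        (by linarith [min_le_right (c : ℝ) (G.len i - c)]) ht₁ ht hT ht₂ hHK hξ hζ hunif hM.1 hM.2
        hS hSI (Nat.one_div_pos_of_nat (n := m)) fun τ hτ => (hSk hτ).2
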